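/- **Setting.** There are $K\ge 1$ arms. Arm $k$ has a parameter space $\Theta_k$ (a topological space) and, for each $\theta\in\Theta_k$, a probability law $P_{k,\theta}$ on $\mathbb{R}^2$ of a (cost, reward) pair $(X,R)$, with $X$ and $R$ integrable and $\mathbb{E}_\theta[X]>0$; its reward rate is $r_k(\theta)=\mathbb{E}_\theta[R]/\mathbb{E}_\theta[X]$. A bandit instance is $\vec\theta=(\theta_1,\dots,\theta_K)$ with $\theta_k\in\Theta_k$; under it the pairs $(X_{n,k},R_{n,k})$, $n\ge 1$, $1\le k\le K$, are independent with $(X_{n,k},R_{n,k})\sim P_{k,\theta_k}$. An admissible policy $\pi$ is a sequence of arm choices $I_n$ such that $\{I_n=k\}$ belongs, for all $n,k$, to the $\sigma$-algebra generated by the pairs observed in epochs $1,\dots,n-1$, i.e. by $(X_{j,I_j},R_{j,I_j})$, $j<n$. Let $T_k^\pi(n)$ be the number of pulls of arm $k$ in the first $n$ epochs, $N_\pi(B)=\inf\{n:\sum_{i\le n}X_{i,I_i}>B\}$, $\mathrm{REW}_\pi(B)=\sum_{i\le N_\pi(B)}R_{i,I_i}$, and $$\mathrm{Reg}_\pi(B)=\sup_{\pi'}\mathbb{E}[\mathrm{REW}_{\pi'}(B)]-\mathbb{E}[\mathrm{REW}_\pi(B)],$$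 the supremum being over all admissible policies. For an instance $\vec\theta$ put $r^*=\max_k r_k(\theta_k)$ and $\Delta_k=r^*-r_k(\theta_k)$. $D(\cdot\|\cdot)$ is the Kullback–Leibler divergence. **Theorem (regret lower bound).** Assume for every arm $k$: 1. (Finiteness) if $r_k(\theta)<r_k(\theta')$, then $D(P_{k,\theta}\|P_{k,\theta'})<\infty$; 2. (Denseness) every neighbourhood of every $\theta\in\Theta_k$ contains some $\theta'$ with $r_k(\theta')>r_k(\theta)$. Let $\pi$ be an admissible policy such that, for every instance $\vec\vartheta$, every arm $k$ that is suboptimal for $\vec\vartheta$ (that is, $r_k(\vartheta_k)<\max_j r_j(\vartheta_j)$) and every $a>0$, $\mathbb{E}_{\vec\vartheta}[T_k^\pi(n)]=o(n^a)$ as $n\to\infty$. Let $\vec\theta$ be an instance such that, for some $\gamma>0$ and all $k$, $\mathbb{E}[|X_{1,k}|^{2+\gamma}]<\infty$, $\mathrm{Var}(R_{1,k})<\infty$, and 3. (Continuity) $\theta\mapsto D(P_{k,\theta_k}\|P_{k,\theta})\in[0,\infty]$ is continuous on $\Theta_k$. Then, under the instance $\vec\theta$, $$\liminf_{B\to\infty}\frac{\mathrm{Reg}_\pi(B)}{\log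 B}\ \ge\ \frac12\sum_{k:\Delta_k>0}\frac{\mathbb{E}[X_{1,k}]\,\Delta_k}{D_k^\star},\qquad D_k^\star=\inf\{D(P_{k,\theta_k}\|P_{k,\theta}):\theta\in\Theta_k,\ r_k(\theta)\ge r^*\},$$ where $\inf\emptyset=\infty$, and for $c>0$, $c/\infty=0$ and $c/0=\infty$. -/

import Mathlib

open MeasureTheory Filter Topology
open scoped ENNReal

noncomputable section

namespace BudgetBandit

/-- An outcome of the whole experiment with `K` arms: for every epoch `n = 0, 1, 2, …` (epochs are
counted from `0`) and every arm `k`, the pair `(cost, reward)` that pulling `k` at epoch `n`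
yields. -/
abbrev Outcome (K : ℕ) : Type := ℕ × Fin K → ℝ × ℝ

/-- The law of the experiment when arm `k` has the cost-reward law `Q k`: pairs of different
epochs or of different arms are independent. -/
def law {K : ℕ} (Q : Fin K → Measure (ℝ × ℝ)) [∀ k, IsProbabilityMeasure (Q k)] :
    Measure (Outcome K) :=
  Measure.infinitePi (fun p : ℕ × Fin K => Q p.2)

/-- The pair `(cost, reward)` observed at epoch `n` when `I m ω` is the arm pulled at epoch `m`. -/
def obs {K : ℕ} (I : ℕ → Outcome K → Fin K) (n : ℕ) (ω : Outcome K) : ℝ × ℝ :=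
  ω (n, I n ω)

/-- The σ-algebra generated by the cost-reward pairs observed in the first `n` epochs. -/
abbrev history {K : ℕ} (I : ℕ → Outcome K → Fin K) (n : ℕ) : MeasurableSpace (Outcome K) :=
  ⨆ j ∈ Finset.range n, MeasurableSpace.comap (obs I j) inferInstance

/-- A sequence of arm pulls is admissible if it is non-anticipating: the arm pulled at an epoch is
determined by what has been observed in the preceding epochs. -/
def Admissible {K : ℕ} (I : ℕ → Outcome K → Fin K) : Prop :=
  ∀ (n : ℕ) (k : Fin K), MeasurableSet[history I n] {ω | I n ω = k}

/-- The total cost of the first `n` epochs. -/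
def totalCost {K : ℕ} (I : ℕ → Outcome K → Fin K) (n : ℕ) (ω : Outcome K) : ℝ :=
  ∑ i ∈ Finset.range n, (obs I i ω).1

/-- The total number of pulls under the budget `B`: the first `n` for which the total cost of `n`
epochs exceeds `B`. (When every expected cost is positive and the costs have finite variances,
such an `n` exists almost surely.) -/
def numPulls {K : ℕ} (I : ℕ → Outcome K → Fin K) (B : ℝ) (ω : Outcome K) : ℕ :=
  sInf {n : ℕ | B < totalCost I n ω}

/-- The cumulative reward under the budget `B`, the reward of the last pull included. -/
def reward {K : ℕ} (I : ℕ → Outcome K → Fin K) (B : ℝ) (ω : Outcome K) : ℝ :=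
  ∑ i ∈ Finset.range (numPulls I B ω), (obs I i ω).2

/-- The number of pulls of arm `k` in the first `n` epochs. -/
def pullCount {K : ℕ} (I : ℕ → Outcome K → Fin K) (k : Fin K) (n : ℕ) (ω : Outcome K) : ℕ :=
  ((Finset.range n).filter (fun i => I i ω = k)).card

/-- The expected cumulative reward of `I` under the budget `B`. -/
def expReward {K : ℕ} (Q : Fin K → Measure (ℝ × ℝ)) [∀ k, IsProbabilityMeasure (Q k)]
    (I : ℕ → Outcome K → Fin K) (B : ℝ) : ℝ :=
  ∫ ω, reward I B ω ∂(law Q)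

/-- The regret of `I` under the budget `B`: the optimal expected cumulative reward over all
admissible policies (which may be tailored to `Q` and `B`) minus that of `I`. The supremum is
taken in the extended reals. -/
def regret {K : ℕ} (Q : Fin K → Measure (ℝ × ℝ)) [∀ k, IsProbabilityMeasure (Q k)]
    (I : ℕ → Outcome K → Fin K) (B : ℝ) : EReal :=
  (⨆ J : {J : ℕ → Outcome K → Fin K // Admissible J}, (expReward Q J.1 B : EReal))
    - (expReward Q I B : EReal)

/-- The expected cost `E[X]` under a cost-reward law. -/
def meanCost (q : Measure (ℝ × ℝ)) : ℝ := ∫ z, z.1 ∂q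

/-- The reward rate `E[R] / E[X]` of a cost-reward law. -/
def rate (q : Measure (ℝ × ℝ)) : ℝ := (∫ z, z.2 ∂q) / meanCost q

/-- The optimal reward rate `r* = max_k r_k`. -/
def optRate {K : ℕ} (Q : Fin K → Measure (ℝ × ℝ)) : ℝ := ⨆ k, rate (Q k)

/-- The gap `Δ_k = r* - r_k`. -/
def gap {K : ℕ} (Q : Fin K → Measure (ℝ × ℝ)) (k : Fin K) : ℝ := optRate Q - rate (Q k)

/-- The minimal Kullback-Leibler divergence `D(q ‖ p θ)` over the parameters `θ` of a family `p`
whose reward rate is at least `ρ` (`∞` if there are none). -/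
def minKL {T : Type*} (q : Measure (ℝ × ℝ)) (p : T → Measure (ℝ × ℝ)) (ρ : ℝ) : ℝ≥0∞ :=
  ⨅ θ ∈ {θ : T | ρ ≤ rate (p θ)}, InformationTheory.klDiv q (p θ)

end BudgetBandit

end

/-! ### Admissible policies: measurability, and the law of an observation given the history. -/

noncomputable section

open ProbabilityTheory

namespace BudgetBandit

variable {K : ℕ}

/-! Up to a bounded term, the regret is at least the cost-weighted number of suboptimal pulls within
the budget, and a consistent policy must pull each suboptimal arm often enough to rule out the
alternatives in which that arm is the best one.

Regret side. Wald's identity (`integral_sum_range_numPulls`) writes expected cost and reward through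
the expected pulls `budgetPulls`. Costs may be negative and unbounded, so the crux is that the
expected overshoot at exit is bounded uniformly in the budget and the policy (`sum_overshoot_le`):
the moment of order `2 + γ` makes a suitable `potential` of the remaining budget a supermartingale
until exit. Hence the expected total cost of every policy lies in `[B, B + C]`, and comparison with
playing one best arm forever gives `le_regret`.

Information side. If only the law of arm `k` is changed, the log-likelihood ratio of the first `n`
observations has mean `E[T_k(n)] * D`. The Donsker-Varadhan inequality (`le_integral_pullCount_mul`)
is applied to `c * log n * (1 - T_k(n) / n)` with `c < 1`: its mean is about `c * log n` under the
true instance, while its exponential moment stays bounded under an alternative where `k` is the only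
best arm. So `E[T_k(n)] * D` is at least `(1 - o(1)) * log n`; denseness and continuity let `D`
approach the infimum `minKL`.

Link. The budget is exceeded within `√B` epochs with probability `O(1 / √B)` only, so `budgetPulls`
is at least `E[T_k(⌊√B⌋)] - O(1)` (`le_budgetPulls`). The factor `1/2` comes from `log √B = (log B)
/ 2`. -/

instance law.instIsProbabilityMeasure (Q : Fin K → Measure (ℝ × ℝ))
    [∀ k, IsProbabilityMeasure (Q k)] : IsProbabilityMeasure (law Q) := by
  unfold law; infer_instance

/-- The σ-algebra generated by all the potential observations of the first `n` epochs. -/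
abbrev past (K n : ℕ) : MeasurableSpace (Outcome K) :=
  ⨆ p ∈ {p : ℕ × Fin K | p.1 < n}, MeasurableSpace.comap (fun ω => ω p) inferInstance

lemma past_mono {m n : ℕ} (h : m ≤ n) : past K m ≤ past K n :=
  biSup_mono fun _ hp => lt_of_lt_of_le hp h

lemma past_le (n : ℕ) : past K n ≤ (inferInstance : MeasurableSpace (Outcome K)) :=
  iSup₂_le fun p _ => (measurable_pi_apply p).comap_le

lemma comap_coord_le_past {n : ℕ} (p : ℕ × Fin K) (hp : p.1 < n) :
    MeasurableSpace.comap (fun ω : Outcome K => ω p) inferInstance ≤ past K n :=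
  le_biSup (fun p : ℕ × Fin K => MeasurableSpace.comap (fun ω : Outcome K => ω p) inferInstance) hp

lemma obs_preimage (I : ℕ → Outcome K → Fin K) (n : ℕ) (t : Set (ℝ × ℝ)) :
    obs I n ⁻¹' t = ⋃ k, ({ω | I n ω = k} ∩ (fun ω => ω (n, k)) ⁻¹' t) := by
  ext ω; simp [obs]

lemma history_mono (I : ℕ → Outcome K → Fin K) {m n : ℕ} (h : m ≤ n) :
    history I m ≤ history I n :=
  biSup_mono fun j hj => by simp only [Finset.mem_range] at hj ⊢; omega

/-- An observation is a coordinate of the outcome selected by the arm pulled, and that selection is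
decided by a shorter history; hence the strong induction. Unlike `history`, `past` is generated by a
fixed block of coordinates, so independence applies to it. -/
lemma history_le_past {I : ℕ → Outcome K → Fin K} (hI : Admissible I) (n : ℕ) :
    history I n ≤ past K n := by
  induction n using Nat.strong_induction_on with
  | _ n ih =>
    refine iSup₂_le fun j hj => ?_
    have hj : j < n := Finset.mem_range.1 hj
    rintro _ ⟨t, ht, rfl⟩
    rw [obs_preimage]
    refine MeasurableSet.iUnion fun k => ?_
    refine MeasurableSet.inter ?_ ?_
    · exact past_mono hj.le _ (ih j hj _ (hI j k))
    · exact comap_coord_le_past (j, k) hj _ ⟨t, ht, rfl⟩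

lemma history_le {I : ℕ → Outcome K → Fin K} (hI : Admissible I) (n : ℕ) :
    history I n ≤ (inferInstance : MeasurableSpace (Outcome K)) :=
  (history_le_past hI n).trans (past_le n)

lemma measurable_arm_history {I : ℕ → Outcome K → Fin K} (hI : Admissible I) (n : ℕ) :
    Measurable[history I n] (I n) :=
  @measurable_to_countable' _ _ _ _ (history I n) _ fun k => hI n k

lemma measurable_arm {I : ℕ → Outcome K → Fin K} (hI : Admissible I) (n : ℕ) :
    Measurable (I n) :=
  (measurable_arm_history hI n).mono (history_le hI n) le_rfl

lemma measurable_obs_history (I : ℕ → Outcome K → Fin K) {m n : ℕ} (h : m < n) :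
    Measurable[history I n] (obs I m) := by
  refine Measurable.mono (comap_measurable (obs I m)) ?_ le_rfl
  exact le_biSup (fun j => MeasurableSpace.comap (obs I j) inferInstance) (Finset.mem_range.2 h)

lemma measurable_obs {I : ℕ → Outcome K → Fin K} (hI : Admissible I) (n : ℕ) :
    Measurable (obs I n) :=
  (measurable_obs_history I (Nat.lt_succ_self n)).mono (history_le hI _) le_rfl

lemma measurable_totalCost_history (I : ℕ → Outcome K → Fin K) {m n : ℕ} (h : m ≤ n) :
    Measurable[history I n] (totalCost I m) := by
  unfold totalCost
  refine Finset.measurable_fun_sum _ fun i hi => ?_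
  exact measurable_fst.comp
    (measurable_obs_history I (lt_of_lt_of_le (Finset.mem_range.1 hi) h))

variable (Q : Fin K → Measure (ℝ × ℝ)) [∀ k, IsProbabilityMeasure (Q k)]

lemma map_coord (p : ℕ × Fin K) : (law Q).map (fun ω => ω p) = Q p.2 :=
  Measure.infinitePi_map_eval _ p

lemma indep_past_coord (n : ℕ) (k : Fin K) :
    Indep (past K n) (MeasurableSpace.comap (fun ω : Outcome K => ω (n, k)) inferInstance)
      (law Q) := by
  have h := (iIndepFun_infinitePi (P := fun p : ℕ × Fin K => Q p.2)
    (X := fun _ x => x) (fun _ => measurable_id)).iIndep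
  have h2 := indep_iSup_of_disjoint (fun p => (measurable_pi_apply p).comap_le) h
    (S := {p : ℕ × Fin K | p.1 < n}) (T := {(n, k)}) (by simp)
  simpa [past, law] using h2

lemma law_inter_coord {n : ℕ} {s : Set (Outcome K)} (hs : MeasurableSet[past K n] s) (k : Fin K)
    {t : Set (ℝ × ℝ)} (ht : MeasurableSet t) :
    law Q (s ∩ (fun ω => ω (n, k)) ⁻¹' t) = law Q s * Q k t := by
  rw [(Indep_iff _ _ _).1 (indep_past_coord Q n k) s _ hs ⟨t, ht, rfl⟩]
  congr 1
  rw [← map_coord Q (n, k), Measure.map_apply (measurable_pi_apply (n, k)) ht]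

/-- The kernel that draws an observation from the arm pulled. -/
def armKernel : Kernel (Fin K) (ℝ × ℝ) := Kernel.ofFunOfCountable Q

instance : IsMarkovKernel (armKernel Q) := ⟨fun k => by
  change IsProbabilityMeasure (Q k); infer_instance⟩

/-- Given the history, the next observation has the law of the arm pulled. -/
lemma map_arm_obs {E : Type*} [MeasurableSpace E] {I : ℕ → Outcome K → Fin K}
    (hI : Admissible I) {n : ℕ} {Y : Outcome K → E} (hY : Measurable[history I n] Y) :
    (law Q).map (fun ω => ((I n ω, Y ω), obs I n ω)) =
      (law Q).map (fun ω => (I n ω, Y ω)) ⊗ₘ (armKernel Q).prodMkRight E := by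
  have hIm := measurable_arm hI n
  have hYm : Measurable Y := hY.mono (history_le hI n) le_rfl
  have hO := measurable_obs hI n
  have hIY : Measurable (fun ω => (I n ω, Y ω)) := hIm.prodMk hYm
  have : IsProbabilityMeasure ((law Q).map (fun ω => ((I n ω, Y ω), obs I n ω))) :=
    Measure.isProbabilityMeasure_map (hIY.prodMk hO).aemeasurable
  have : IsProbabilityMeasure ((law Q).map (fun ω => (I n ω, Y ω))) :=
    Measure.isProbabilityMeasure_map hIY.aemeasurable
  refine Measure.ext_prod fun {s t} hs ht => ?_
  rw [Measure.compProd_apply_prod hs ht, Measure.map_apply (hIY.prodMk hO) (hs.prod ht),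
    setLIntegral_map hs (Kernel.measurable_coe _ ht) hIY]
  set A : Set (Outcome K) := (fun ω => (I n ω, Y ω)) ⁻¹' s with hA
  have hAm : MeasurableSet[history I n] A :=
    ((measurable_arm_history hI n).prodMk hY) hs
  have e1 : ∫⁻ ω in A, ((armKernel Q).prodMkRight E) (I n ω, Y ω) t ∂law Q
      = ∑ k, Q k t * law Q ({ω | I n ω = k} ∩ A) := by
    have : ∫⁻ ω in A, ((armKernel Q).prodMkRight E) (I n ω, Y ω) t ∂law Q
        = ∫⁻ k, Q k t ∂(((law Q).restrict A).map (I n)) := by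
      rw [lintegral_map (measurable_of_countable _) hIm]; rfl
    rw [this, lintegral_fintype]
    refine Finset.sum_congr rfl fun k _ => ?_
    rw [Measure.map_apply hIm (measurableSet_singleton k),
      Measure.restrict_apply (hIm (measurableSet_singleton k))]
    rfl
  rw [e1]
  -- Where arm `k` is pulled, the observation is the coordinate `(n, k)`, which is independent of
  -- the past.
  have e2 : (fun ω => ((I n ω, Y ω), obs I n ω)) ⁻¹' s ×ˢ t =
      ⋃ k, (({ω | I n ω = k} ∩ A) ∩ (fun ω => ω (n, k)) ⁻¹' t) := by
    ext ω; simp [hA, obs]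
  rw [e2, measure_iUnion, tsum_fintype]
  · refine Finset.sum_congr rfl fun k _ => ?_
    rw [law_inter_coord Q (history_le_past hI n _ ((hI n k).inter hAm)) k ht, mul_comm]
  · intro i j hij
    refine Set.disjoint_left.2 fun ω h1 h2 => hij ?_
    exact h1.1.1.symm.trans h2.1.1
  · intro k
    exact (((history_le hI n _ (hI n k)).inter (history_le hI n _ hAm))).inter
      (measurable_pi_apply _ ht)

lemma lintegral_arm_obs {E : Type*} [MeasurableSpace E] {I : ℕ → Outcome K → Fin K}
    (hI : Admissible I) {n : ℕ} {Y : Outcome K → E} (hY : Measurable[history I n] Y)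
    {f : (Fin K × E) × (ℝ × ℝ) → ℝ≥0∞} (hf : Measurable f) :
    ∫⁻ ω, f ((I n ω, Y ω), obs I n ω) ∂law Q =
      ∫⁻ ω, ∫⁻ z, f ((I n ω, Y ω), z) ∂Q (I n ω) ∂law Q := by
  have hIY : Measurable (fun ω => (I n ω, Y ω)) :=
    (measurable_arm hI n).prodMk (hY.mono (history_le hI n) le_rfl)
  rw [← lintegral_map hf (hIY.prodMk (measurable_obs hI n)), map_arm_obs Q hI hY,
    Measure.lintegral_compProd hf, lintegral_map _ hIY]
  · rfl
  · exact hf.lintegral_kernel_prod_right'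

lemma integral_arm_obs {E : Type*} [MeasurableSpace E] {I : ℕ → Outcome K → Fin K}
    (hI : Admissible I) {n : ℕ} {Y : Outcome K → E} (hY : Measurable[history I n] Y)
    {f : (Fin K × E) × (ℝ × ℝ) → ℝ} (hf : Measurable f)
    (hfi : Integrable (fun ω => f ((I n ω, Y ω), obs I n ω)) (law Q)) :
    ∫ ω, f ((I n ω, Y ω), obs I n ω) ∂law Q =
      ∫ ω, ∫ z, f ((I n ω, Y ω), z) ∂Q (I n ω) ∂law Q := by
  have hIY : Measurable (fun ω => (I n ω, Y ω)) :=
    (measurable_arm hI n).prodMk (hY.mono (history_le hI n) le_rfl)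
  have hm := (hIY.prodMk (measurable_obs hI n))
  have h1 : Integrable f ((law Q).map (fun ω => ((I n ω, Y ω), obs I n ω))) :=
    (integrable_map_measure hf.aestronglyMeasurable hm.aemeasurable).2 hfi
  rw [← integral_map hm.aemeasurable hf.aestronglyMeasurable]
  rw [map_arm_obs Q hI hY] at h1 ⊢
  rw [Measure.integral_compProd h1, integral_map hIY.aemeasurable]
  · rfl
  · exact (hf.stronglyMeasurable.integral_kernel_prod_right').aestronglyMeasurable

lemma integrable_arm_obs {I : ℕ → Outcome K → Fin K} (hI : Admissible I) (n : ℕ)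
    {f : Fin K → ℝ × ℝ → ℝ} (hf : ∀ k, Integrable (f k) (Q k)) :
    Integrable (fun ω => f (I n ω) (obs I n ω)) (law Q) := by
  have h : (fun ω => f (I n ω) (obs I n ω)) =
      fun ω => ∑ k, ({ω | I n ω = k}).indicator (fun ω => f k (ω (n, k))) ω := by
    ext ω
    rw [Finset.sum_eq_single (I n ω)]
    · simp [obs]
    · intro k _ hk; simp [hk.symm]
    · simp
  rw [h]
  refine integrable_finsetSum _ fun k _ => ?_
  refine Integrable.indicator ?_ (history_le hI n _ (hI n k))
  have := hf k
  rw [← map_coord Q (n, k)] at this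
  exact this.comp_measurable (measurable_pi_apply _)

lemma integrable_obs {I : ℕ → Outcome K → Fin K} (hI : Admissible I) (n : ℕ)
    {f : ℝ × ℝ → ℝ} (hf : ∀ k, Integrable f (Q k)) :
    Integrable (fun ω => f (obs I n ω)) (law Q) :=
  integrable_arm_obs Q hI n (f := fun _ => f) hf

/-- The expectation of a function of the arm pulled and the observation at epoch `n`, on an event
of the past. -/
lemma setIntegral_arm_obs {I : ℕ → Outcome K → Fin K} (hI : Admissible I) {n : ℕ}
    {A : Set (Outcome K)} (hA : MeasurableSet[history I n] A) {f : Fin K → ℝ × ℝ → ℝ}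
    (hfm : ∀ k, Measurable (f k)) (hf : ∀ k, Integrable (f k) (Q k)) :
    ∫ ω in A, f (I n ω) (obs I n ω) ∂law Q =
      ∑ k, (law Q).real (A ∩ {ω | I n ω = k}) * ∫ z, f k z ∂Q k := by
  have hAm := history_le hI n _ hA
  have hY : Measurable[history I n] (A.indicator (fun _ => (1 : ℝ))) :=
    (@measurable_const _ _ _ (history I n) (1 : ℝ)).indicator hA
  have e0 : ∀ ω, A.indicator (fun ω => f (I n ω) (obs I n ω)) ω =
      A.indicator (fun _ => (1 : ℝ)) ω * f (I n ω) (obs I n ω) := by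
    intro ω; by_cases h : ω ∈ A <;> simp [h]
  have hint := (integrable_arm_obs Q hI n hf).indicator hAm
  have hfm' : Measurable fun p : Fin K × (ℝ × ℝ) => f p.1 p.2 :=
    measurable_from_prod_countable_right hfm
  have := integral_arm_obs Q hI hY (f := fun p => p.1.2 * f p.1.1 p.2)
    (by
      have : Measurable fun p : (Fin K × ℝ) × (ℝ × ℝ) => f p.1.1 p.2 :=
        hfm'.comp ((measurable_fst.comp measurable_fst).prodMk measurable_snd)
      fun_prop)
    (by simpa only [← e0] using hint)
  rw [← integral_indicator hAm]
  simp only [e0]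
  rw [this]
  have e1 : ∀ ω, ∫ z, A.indicator (fun _ => (1 : ℝ)) ω * f (I n ω) z ∂Q (I n ω) =
      ∑ k, (A ∩ {ω | I n ω = k}).indicator (fun _ => ∫ z, f k z ∂Q k) ω := by
    intro ω
    rw [integral_const_mul, Finset.sum_eq_single (I n ω)]
    · by_cases h : ω ∈ A <;> simp [h]
    · intro k _ hk; simp [hk.symm]
    · simp
  simp only [e1]
  have hm : ∀ k, MeasurableSet (A ∩ {ω | I n ω = k}) :=
    fun k => hAm.inter (history_le hI n _ (hI n k))
  rw [integral_finsetSum _ fun k _ => (integrable_const _).indicator (hm k)]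
  refine Finset.sum_congr rfl fun k _ => ?_
  rw [integral_indicator_const _ (hm k), smul_eq_mul]

lemma setIntegral_obs {I : ℕ → Outcome K → Fin K} (hI : Admissible I) {n : ℕ}
    {A : Set (Outcome K)} (hA : MeasurableSet[history I n] A) {f : ℝ × ℝ → ℝ}
    (hfm : Measurable f) (hf : ∀ k, Integrable f (Q k)) :
    ∫ ω in A, f (obs I n ω) ∂law Q =
      ∑ k, (law Q).real (A ∩ {ω | I n ω = k}) * ∫ z, f z ∂Q k :=
  setIntegral_arm_obs Q hI hA (f := fun _ => f) (fun _ => hfm) hf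

lemma ae_arm_obs {I : ℕ → Outcome K → Fin K} (n : ℕ) {p : Fin K → ℝ × ℝ → Prop}
    (h : ∀ k, ∀ᵐ z ∂Q k, p k z) : ∀ᵐ ω ∂law Q, p (I n ω) (obs I n ω) := by
  have h1 : ∀ᵐ ω ∂law Q, ∀ k, p k (ω (n, k)) := by
    refine ae_all_iff.2 fun k => ?_
    have := h k
    rw [← map_coord Q (n, k)] at this
    exact ae_of_ae_map (measurable_pi_apply _).aemeasurable this
  filter_upwards [h1] with ω hω using hω (I n ω)

lemma pullCount_eq_sum (I : ℕ → Outcome K → Fin K) (k : Fin K) (n : ℕ) (ω : Outcome K) :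
    (pullCount I k n ω : ℝ) =
      ∑ i ∈ Finset.range n, ({ω | I i ω = k}).indicator (fun _ => (1 : ℝ)) ω := by
  simp only [pullCount, Set.indicator_apply, Set.mem_ofPred_eq, Finset.sum_boole]

lemma integral_pullCount {I : ℕ → Outcome K → Fin K} (hI : Admissible I) (k : Fin K) (n : ℕ) :
    ∫ ω, (pullCount I k n ω : ℝ) ∂law Q =
      ∑ i ∈ Finset.range n, (law Q).real {ω | I i ω = k} := by
  have hm : ∀ i, MeasurableSet {ω | I i ω = k} := fun i => history_le hI i _ (hI i k)
  simp only [pullCount_eq_sum]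
  rw [integral_finsetSum _ fun i _ => (integrable_const _).indicator (hm i)]
  refine Finset.sum_congr rfl fun i _ => ?_
  rw [integral_indicator_const _ (hm i), smul_eq_mul, mul_one]

end BudgetBandit

end

/-! ### The potential of the remaining budget and its negative drift. -/

noncomputable section

namespace BudgetBandit

/-- A bounded concave function of the remaining budget `d`, linear where the budget is exceeded. -/
def concavePotential (L γ d : ℝ) : ℝ :=
  if 0 ≤ d then L / γ * (1 - (1 + d / L) ^ (-γ)) else d

/-- The potential of a remaining budget: it grows at least linearly in the overshoot. -/
def potential (L γ d : ℝ) : ℝ := concavePotential L γ d + 2 * max (-d - L) 0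

lemma measurable_concavePotential (L γ : ℝ) : Measurable (concavePotential L γ) := by
  unfold concavePotential
  exact Measurable.ite measurableSet_Ici (by fun_prop) measurable_id

lemma measurable_potential (L γ : ℝ) : Measurable (potential L γ) := by
  unfold potential
  have := measurable_concavePotential L γ
  fun_prop

lemma rpow_neg_bernoulli {u γ : ℝ} (hu : 0 < u) (hγ : 0 < γ) :
    1 - γ * (u - 1) ≤ u ^ (-γ) := by
  rw [Real.rpow_def_of_pos hu]
  have h1 := Real.add_one_le_exp (Real.log u * -γ)
  have h2 := mul_le_mul_of_nonneg_left (Real.log_le_sub_one_of_pos hu) hγ.le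
  linarith

/-- For `e ≥ 0` this is the Bernoulli inequality at the ratio `(1 + e / L) / (1 + d / L)`. For `e <
0` the graph continues with slope one, which is at least the slope at `d`, so the tangent stays
above it. -/
lemma concavePotential_le_tangent {L γ d e : ℝ} (hL : 0 < L) (hγ : 0 < γ) (hd : 0 ≤ d) :
    concavePotential L γ e ≤
      concavePotential L γ d + (1 + d / L) ^ (-(1 + γ)) * (e - d) := by
  have ht : 1 ≤ 1 + d / L := by have := div_nonneg hd hL.le; linarith
  have ht0 : 0 < 1 + d / L := by linarith
  have key : ∀ e, 0 ≤ e → concavePotential L γ e ≤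
      concavePotential L γ d + (1 + d / L) ^ (-(1 + γ)) * (e - d) := by
    intro e he
    have hs0 : 0 < 1 + e / L := by have := div_nonneg he hL.le; linarith
    simp only [concavePotential, if_pos hd, if_pos he]
    have hb := rpow_neg_bernoulli (div_pos hs0 ht0) hγ
    rw [Real.div_rpow hs0.le ht0.le, le_div_iff₀ (Real.rpow_pos_of_pos ht0 _)] at hb
    have e1 : (1 + d / L) ^ (-(1 + γ)) = (1 + d / L) ^ (-γ) / (1 + d / L) := by
      rw [show -(1 + γ) = -γ - 1 by ring, Real.rpow_sub_one ht0.ne']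
    rw [e1]
    have e2 : (1 - γ * ((1 + e / L) / (1 + d / L) - 1)) * (1 + d / L) ^ (-γ) =
        (1 + d / L) ^ (-γ) - γ / L * ((1 + d / L) ^ (-γ) / (1 + d / L) * (e - d)) := by
      field_simp
      ring
    rw [e2] at hb
    have hc : 0 < L / γ := div_pos hL hγ
    have h3 := mul_le_mul_of_nonneg_left hb hc.le
    have e3 : L / γ * ((1 + d / L) ^ (-γ) -
        γ / L * ((1 + d / L) ^ (-γ) / (1 + d / L) * (e - d))) =
        L / γ * (1 + d / L) ^ (-γ) - (1 + d / L) ^ (-γ) / (1 + d / L) * (e - d) := by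
      field_simp
    rw [e3] at h3
    linarith
  rcases le_or_gt 0 e with he | he
  · exact key e he
  · have h0 := key 0 le_rfl
    have hs : (1 + d / L) ^ (-(1 + γ)) ≤ 1 :=
      Real.rpow_le_one_of_one_le_of_nonpos ht (by linarith)
    have e0 : concavePotential L γ 0 = 0 := by simp [concavePotential]
    rw [e0] at h0
    have : concavePotential L γ e = e := by simp [concavePotential, he]
    rw [this]
    nlinarith

lemma concavePotential_nonneg {L γ d : ℝ} (hL : 0 < L) (hγ : 0 < γ) (hd : 0 ≤ d) :
    0 ≤ concavePotential L γ d := by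
  simp only [concavePotential, if_pos hd]
  have ht : 1 ≤ 1 + d / L := by have := div_nonneg hd hL.le; linarith
  have := Real.rpow_le_one_of_one_le_of_nonpos ht (neg_nonpos.2 hγ.le)
  have hc : 0 < L / γ := div_pos hL hγ
  exact mul_nonneg hc.le (by linarith)

lemma concavePotential_le {L γ d : ℝ} (hL : 0 < L) (hγ : 0 < γ) :
    concavePotential L γ d ≤ L / γ := by
  have hc : 0 < L / γ := div_pos hL hγ
  unfold concavePotential
  split_ifs with hd
  · have ht : 0 < 1 + d / L := by have := div_nonneg hd hL.le; linarith
    have := Real.rpow_pos_of_pos ht (-γ)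
    nlinarith
  · linarith

lemma potential_nonneg {L γ d : ℝ} (hL : 0 < L) (hγ : 0 < γ) (hd : 0 ≤ d) :
    0 ≤ potential L γ d :=
  add_nonneg (concavePotential_nonneg hL hγ hd) (by positivity)

lemma potential_le {L γ d : ℝ} (hL : 0 < L) (hγ : 0 < γ) (hd : 0 ≤ d) :
    potential L γ d ≤ L / γ := by
  have h : max (-d - L) 0 = 0 := max_eq_right (by linarith)
  rw [potential, h, mul_zero, add_zero]
  exact concavePotential_le hL hγ

/-- The factor `2` in `potential` outweighs the slope one of the concave part: far below zero the
potential rises again and dominates the overshoot. -/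
lemma overshoot_le_potential {L γ d : ℝ} (hd : d < 0) :
    -d - 2 * L ≤ potential L γ d := by
  have h := le_max_left (-d - L) 0
  rw [potential, concavePotential, if_neg hd.not_ge]
  linarith

lemma abs_potential_le {L γ : ℝ} (hL : 0 < L) (hγ : 0 < γ) (d : ℝ) :
    |potential L γ d| ≤ L / γ + 3 * |d| := by
  have hc : 0 < L / γ := div_pos hL hγ
  rcases le_or_gt 0 d with hd | hd
  · rw [abs_of_nonneg (potential_nonneg hL hγ hd)]
    have := potential_le hL hγ hd
    have := abs_nonneg d
    linarith
  · rw [potential, concavePotential, if_neg hd.not_ge, abs_of_neg hd]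
    have h1 : max (-d - L) 0 ≤ -d := max_le (by linarith) (by linarith)
    have h2 : 0 ≤ max (-d - L) 0 := le_max_right _ _
    rw [abs_le]; constructor <;> linarith

/-- Where `x > y`, the factor `(x / y) ^ (1 + γ)` is at least one. The exponent makes the bound
decay in `y` exactly as fast as the slope of `concavePotential`, so the drift can absorb it at every
budget level. -/
lemma max_sub_le_rpow {γ x y : ℝ} (hγ : 0 < γ) (hy : 0 < y) :
    max (x - y) 0 ≤ |x| ^ (2 + γ) * y ^ (-(1 + γ)) := by
  refine max_le ?_ (by positivity)
  rcases le_or_gt x y with h | h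
  · exact (sub_nonpos.2 h).trans (by positivity)
  · have hx : 0 < x := hy.trans h
    rw [abs_of_pos hx, show (2 + γ) = 1 + (1 + γ) by ring, Real.rpow_add hx, Real.rpow_one,
      Real.rpow_neg hy.le, mul_assoc, ← div_eq_mul_inv, ← Real.div_rpow hx.le hy.le]
    have : 1 ≤ (x / y) ^ (1 + γ) := Real.one_le_rpow ((one_le_div hy).2 h.le) (by linarith)
    nlinarith

/-- The potential decreases in expectation while the budget is not exceeded. -/
lemma integral_potential_sub_le {α : Type*} [MeasurableSpace α] {q : Measure α}
    [IsProbabilityMeasure q] {x : α → ℝ} {L γ M : ℝ} (hL : 0 < L) (hγ : 0 < γ)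
    (hx : Integrable x q) (hxm : Integrable (fun z => |x z| ^ (2 + γ)) q)
    (hM : ∫ z, |x z| ^ (2 + γ) ∂q ≤ M) (hLM : 2 * M ≤ L ^ (1 + γ) * ∫ z, x z ∂q)
    {d : ℝ} (hd : 0 ≤ d) :
    ∫ z, (potential L γ (d - x z) - potential L γ d) ∂q ≤ 0 := by
  have ht : 0 < 1 + d / L := by have := div_nonneg hd hL.le; linarith
  have hdL : 0 < d + L := by linarith
  set s := (1 + d / L) ^ (-(1 + γ)) with hs
  -- The slope at `d` and the tail bound both scale as `(d + L) ^ (-(1 + γ))`; this power cancels,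
  -- and `hLM` settles all `d ≥ 0` at once.
  have hs' : s = L ^ (1 + γ) * (d + L) ^ (-(1 + γ)) := by
    rw [hs, show 1 + d / L = (d + L) / L by field_simp; ring, Real.div_rpow hdL.le hL.le,
      Real.rpow_neg hL.le, div_inv_eq_mul, mul_comm]
  have hpt : ∀ z, potential L γ (d - x z) - potential L γ d ≤
      -(s * x z) + 2 * (|x z| ^ (2 + γ) * (d + L) ^ (-(1 + γ))) := by
    intro z
    have h1 := concavePotential_le_tangent (e := d - x z) hL hγ hd
    have h2 := max_sub_le_rpow (x := x z) hγ hdL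
    have h3 : max (-d - L) 0 = 0 := max_eq_right (by linarith)
    rw [potential, potential, h3, show -(d - x z) - L = x z - (d + L) by ring]
    rw [← hs] at h1
    linarith
  have hneg : Integrable (fun z => -(s * x z)) q := (hx.const_mul s).neg
  have hint : Integrable (fun z => -(s * x z) +
      2 * (|x z| ^ (2 + γ) * (d + L) ^ (-(1 + γ)))) q :=
    hneg.add ((hxm.mul_const _).const_mul 2)
  have hpos : 0 < (d + L) ^ (-(1 + γ)) := Real.rpow_pos_of_pos hdL _
  have hval : ∫ z, (-(s * x z) + 2 * (|x z| ^ (2 + γ) * (d + L) ^ (-(1 + γ)))) ∂q ≤ 0 := by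
    rw [integral_add hneg ((hxm.mul_const _).const_mul 2), integral_neg,
      integral_const_mul, integral_const_mul, integral_mul_const, hs']
    nlinarith
  -- Otherwise the integral is `0` by convention.
  by_cases hi : Integrable (fun z => potential L γ (d - x z) - potential L γ d) q
  · exact (integral_mono hi hint hpt).trans hval
  · rw [integral_undef hi]

end BudgetBandit

end

/-! ### Uniform bound on the expected overshoot. -/

noncomputable section

namespace BudgetBandit

variable {K : ℕ}

/-- The event that the budget `B` has not been exceeded in the first `n` epochs. -/
def alive (I : ℕ → Outcome K → Fin K) (B : ℝ) (n : ℕ) : Set (Outcome K) :=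
  {ω | ∀ j ≤ n, totalCost I j ω ≤ B}

lemma alive_anti (I : ℕ → Outcome K → Fin K) (B : ℝ) {m n : ℕ} (h : m ≤ n) :
    alive I B n ⊆ alive I B m :=
  fun _ hω j hj => hω j (hj.trans h)

lemma alive_zero (I : ℕ → Outcome K → Fin K) {B : ℝ} (hB : 0 ≤ B) : alive I B 0 = Set.univ := by
  ext ω; simp [alive, totalCost, hB]

lemma totalCost_le_of_alive {I : ℕ → Outcome K → Fin K} {B : ℝ} {n : ℕ} {ω : Outcome K}
    (h : ω ∈ alive I B n) : totalCost I n ω ≤ B := h n le_rfl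

lemma lt_totalCost_of_exit {I : ℕ → Outcome K → Fin K} {B : ℝ} {n : ℕ} {ω : Outcome K}
    (h : ω ∈ alive I B n \ alive I B (n + 1)) : B < totalCost I (n + 1) ω := by
  by_contra! hle
  refine h.2 fun j hj => ?_
  rcases Nat.le_succ_iff.1 hj with hj | rfl
  · exact h.1 j hj
  · exact hle

lemma measurableSet_alive_history (I : ℕ → Outcome K → Fin K) (B : ℝ) (n : ℕ) :
    MeasurableSet[history I n] (alive I B n) := by
  have : alive I B n = ⋂ j, ⋂ (_ : j ≤ n), {ω | totalCost I j ω ≤ B} := by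
    ext ω; simp [alive]
  rw [this]
  exact MeasurableSet.iInter fun j => MeasurableSet.iInter fun hj =>
    measurable_totalCost_history I hj measurableSet_Iic

lemma measurableSet_alive {I : ℕ → Outcome K → Fin K} (hI : Admissible I) (B : ℝ) (n : ℕ) :
    MeasurableSet (alive I B n) :=
  history_le hI n _ (measurableSet_alive_history I B n)

lemma totalCost_succ (I : ℕ → Outcome K → Fin K) (n : ℕ) (ω : Outcome K) :
    totalCost I (n + 1) ω = totalCost I n ω + (obs I n ω).1 :=
  Finset.sum_range_succ _ _

variable (Q : Fin K → Measure (ℝ × ℝ)) [∀ k, IsProbabilityMeasure (Q k)]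

lemma integrable_totalCost {I : ℕ → Outcome K → Fin K} (hI : Admissible I)
    (hX : ∀ k, Integrable (fun z : ℝ × ℝ => z.1) (Q k)) (n : ℕ) :
    Integrable (totalCost I n) (law Q) :=
  integrable_finsetSum _ fun i _ => integrable_obs Q hI i hX

lemma integrable_potential {I : ℕ → Outcome K → Fin K} (hI : Admissible I)
    (hX : ∀ k, Integrable (fun z : ℝ × ℝ => z.1) (Q k)) {L γ : ℝ} (hL : 0 < L) (hγ : 0 < γ)
    (B : ℝ) (n : ℕ) :
    Integrable (fun ω => potential L γ (B - totalCost I n ω)) (law Q) := by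
  have hS := integrable_totalCost Q hI hX n
  have hSm : Measurable (totalCost I n) :=
    (measurable_totalCost_history I le_rfl).mono (history_le hI n) le_rfl
  refine Integrable.mono' (g := fun ω => L / γ + 3 * |B - totalCost I n ω|) ?_
    ((measurable_potential L γ).comp (hSm.const_sub B)).aestronglyMeasurable
    (Eventually.of_forall fun ω => ?_)
  · exact (integrable_const _).add (((integrable_const B).sub hS).abs.const_mul 3)
  · exact abs_potential_le hL hγ _

/-- The supermartingale property up to exit: the drift is nonpositive for every arm, hence for
whichever arm the history selects. -/
lemma setIntegral_potential_succ_le {I : ℕ → Outcome K → Fin K} (hI : Admissible I)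
    (hX : ∀ k, Integrable (fun z : ℝ × ℝ => z.1) (Q k)) {L γ M : ℝ} (hL : 0 < L) (hγ : 0 < γ)
    (hXm : ∀ k, Integrable (fun z : ℝ × ℝ => |z.1| ^ (2 + γ)) (Q k))
    (hM : ∀ k, ∫ z, |z.1| ^ (2 + γ) ∂Q k ≤ M)
    (hLM : ∀ k, 2 * M ≤ L ^ (1 + γ) * meanCost (Q k)) (B : ℝ) (n : ℕ) :
    ∫ ω in alive I B n, potential L γ (B - totalCost I (n + 1) ω) ∂law Q ≤
      ∫ ω in alive I B n, potential L γ (B - totalCost I n ω) ∂law Q := by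
  have hi1 := integrable_potential Q hI hX hL hγ B (n + 1)
  have hi0 := integrable_potential Q hI hX hL hγ B n
  have hA := measurableSet_alive hI B n
  rw [← sub_nonpos, ← integral_sub hi1.integrableOn hi0.integrableOn, ← integral_indicator hA]
  -- The history enters only through being within budget and through the budget left.
  set Y : Outcome K → ℝ × ℝ :=
    fun ω => ((alive I B n).indicator (fun _ => (1 : ℝ)) ω, B - totalCost I n ω) with hYdef
  have hY : Measurable[history I n] Y := by
    refine Measurable.prodMk ?_ ?_
    · exact (@measurable_const _ _ _ (history I n) (1 : ℝ)).indicator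
        (measurableSet_alive_history I B n)
    · exact (measurable_totalCost_history I le_rfl).const_sub B
  set f : (Fin K × (ℝ × ℝ)) × (ℝ × ℝ) → ℝ := fun p =>
    p.1.2.1 * (potential L γ (p.1.2.2 - p.2.1) - potential L γ p.1.2.2) with hf
  have hV := measurable_potential L γ
  have hfm : Measurable f := by rw [hf]; fun_prop
  have e0 : ∀ ω, (alive I B n).indicator (fun ω => potential L γ (B - totalCost I (n + 1) ω) -
      potential L γ (B - totalCost I n ω)) ω = f ((I n ω, Y ω), obs I n ω) := by
    intro ω
    have : B - totalCost I n ω - (obs I n ω).1 = B - totalCost I (n + 1) ω := by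
      rw [totalCost_succ]; ring
    by_cases h : ω ∈ alive I B n <;> simp [hf, hYdef, h, this]
  have hfi : Integrable (fun ω => f ((I n ω, Y ω), obs I n ω)) (law Q) := by
    simp only [← e0]
    exact (hi1.sub hi0).indicator hA
  simp only [e0]
  rw [integral_arm_obs Q hI hY hfm hfi]
  refine integral_nonpos fun ω => ?_
  simp only [hf, hYdef, Pi.zero_apply]
  rw [integral_const_mul]
  by_cases h : ω ∈ alive I B n
  · rw [Set.indicator_of_mem h, one_mul]
    exact integral_potential_sub_le hL hγ (hX _) (hXm _) (hM _) (hLM _)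
      (sub_nonneg.2 (totalCost_le_of_alive h))
  · simp [h]

lemma sum_measureReal_exit {I : ℕ → Outcome K → Fin K} (hI : Admissible I) {B : ℝ}
    (hB : 0 ≤ B) (n : ℕ) :
    ∑ i ∈ Finset.range n, (law Q).real (alive I B i \ alive I B (i + 1)) =
      1 - (law Q).real (alive I B n) := by
  have h : ∀ i, (law Q).real (alive I B i \ alive I B (i + 1)) =
      (law Q).real (alive I B i) - (law Q).real (alive I B (i + 1)) := fun i =>
    measureReal_sdiff (alive_anti I B (Nat.le_succ i)) (measurableSet_alive hI B (i + 1))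
  simp only [h]
  rw [Finset.sum_range_sub', alive_zero I hB]
  simp

/-- The expected overshoot over the budget is bounded uniformly in the budget and the policy. -/
lemma sum_overshoot_le {I : ℕ → Outcome K → Fin K} (hI : Admissible I)
    (hX : ∀ k, Integrable (fun z : ℝ × ℝ => z.1) (Q k)) {L γ M : ℝ} (hL : 0 < L) (hγ : 0 < γ)
    (hXm : ∀ k, Integrable (fun z : ℝ × ℝ => |z.1| ^ (2 + γ)) (Q k))
    (hM : ∀ k, ∫ z, |z.1| ^ (2 + γ) ∂Q k ≤ M)
    (hLM : ∀ k, 2 * M ≤ L ^ (1 + γ) * meanCost (Q k)) {B : ℝ} (hB : 0 ≤ B) (n : ℕ) :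
    ∑ i ∈ Finset.range n, ∫ ω in alive I B i \ alive I B (i + 1),
      (totalCost I (i + 1) ω - B) ∂law Q ≤ L / γ + 2 * L := by
  -- The overshoot at an exit is paid for by `2 * L` and a drop of the potential. The drops
  -- telescope from an initial value of at most `L / γ` to a nonnegative one, and the exit
  -- probabilities sum to at most one.
  have hmono : ∀ i, ∫ ω in alive I B i \ alive I B (i + 1), (totalCost I (i + 1) ω - B) ∂law Q ≤
      2 * L * (law Q).real (alive I B i \ alive I B (i + 1)) +
      (∫ ω in alive I B i, potential L γ (B - totalCost I i ω) ∂law Q -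
        ∫ ω in alive I B (i + 1), potential L γ (B - totalCost I (i + 1) ω) ∂law Q) := by
    intro i
    have hS := integrable_totalCost Q hI hX (i + 1)
    have hV := integrable_potential Q hI hX hL hγ B (i + 1)
    have hD : MeasurableSet (alive I B i \ alive I B (i + 1)) :=
      (measurableSet_alive hI B i).diff (measurableSet_alive hI B (i + 1))
    have h1 : ∫ ω in alive I B i \ alive I B (i + 1), (totalCost I (i + 1) ω - B) ∂law Q ≤
        ∫ ω in alive I B i \ alive I B (i + 1),
          (2 * L + potential L γ (B - totalCost I (i + 1) ω)) ∂law Q := by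
      refine setIntegral_mono_on (hS.sub (integrable_const B)).integrableOn
        ((integrable_const _).add hV).integrableOn hD fun ω hω => ?_
      have h := overshoot_le_potential (L := L) (γ := γ) (sub_neg.2 (lt_totalCost_of_exit hω))
      linarith
    rw [integral_add (integrable_const _) hV.integrableOn, setIntegral_const, smul_eq_mul,
      setIntegral_sdiff (measurableSet_alive hI B (i + 1)) hV.integrableOn
        (alive_anti I B (Nat.le_succ i))] at h1
    have h2 := setIntegral_potential_succ_le Q hI hX hL hγ hXm hM hLM B i
    linarith
  refine (Finset.sum_le_sum fun i _ => hmono i).trans ?_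
  rw [Finset.sum_add_distrib, ← Finset.mul_sum, sum_measureReal_exit Q hI hB,
    Finset.sum_range_sub', alive_zero I hB]
  have h0 : ∫ ω in Set.univ, potential L γ (B - totalCost I 0 ω) ∂law Q ≤ L / γ := by
    simp only [totalCost, Finset.range_zero, Finset.sum_empty, sub_zero]
    simpa using potential_le hL hγ hB
  have hn : 0 ≤ ∫ ω in alive I B n, potential L γ (B - totalCost I n ω) ∂law Q :=
    setIntegral_nonneg (measurableSet_alive hI B n) fun ω hω =>
      potential_nonneg hL hγ (sub_nonneg.2 (totalCost_le_of_alive hω))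
  have h3 : 0 ≤ (law Q).real (alive I B n) := measureReal_nonneg
  nlinarith

/-- The expected cost accumulated up to epoch `n` while within budget. -/
lemma sum_setIntegral_cost_le {I : ℕ → Outcome K → Fin K} (hI : Admissible I)
    (hX : ∀ k, Integrable (fun z : ℝ × ℝ => z.1) (Q k)) {B : ℝ} (hB : 0 ≤ B) (n : ℕ) :
    ∑ i ∈ Finset.range n, ∫ ω in alive I B i, (obs I i ω).1 ∂law Q ≤
      B + ∑ i ∈ Finset.range n, ∫ ω in alive I B i \ alive I B (i + 1),
        (totalCost I (i + 1) ω - B) ∂law Q := by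
  -- Summation by parts: cost accumulated within budget either leaves at an exit, as `B` plus the
  -- overshoot, or is still carried by the outcomes alive, where it is at most `B`.
  have hstep : ∀ i, ∫ ω in alive I B i, (obs I i ω).1 ∂law Q =
      (∫ ω in alive I B i \ alive I B (i + 1), (totalCost I (i + 1) ω - B) ∂law Q +
      B * (law Q).real (alive I B i \ alive I B (i + 1))) -
      (∫ ω in alive I B i, totalCost I i ω ∂law Q -
        ∫ ω in alive I B (i + 1), totalCost I (i + 1) ω ∂law Q) := by
    intro i
    have hS := integrable_totalCost Q hI hX (i + 1)
    have hS0 := integrable_totalCost Q hI hX i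
    have hXi := integrable_obs Q hI i hX
    rw [integral_sub hS.integrableOn (integrable_const B), setIntegral_const, smul_eq_mul,
      setIntegral_sdiff (measurableSet_alive hI B (i + 1)) hS.integrableOn
        (alive_anti I B (Nat.le_succ i))]
    have : ∫ ω in alive I B i, totalCost I (i + 1) ω ∂law Q =
        ∫ ω in alive I B i, totalCost I i ω ∂law Q + ∫ ω in alive I B i, (obs I i ω).1 ∂law Q := by
      rw [← integral_add hS0.integrableOn hXi.integrableOn]
      simp only [totalCost_succ]
    rw [this]; ring
  simp only [hstep]
  rw [Finset.sum_sub_distrib, Finset.sum_add_distrib, ← Finset.mul_sum,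
    sum_measureReal_exit Q hI hB, Finset.sum_range_sub']
  have h0 : ∫ ω in alive I B 0, totalCost I 0 ω ∂law Q = 0 := by simp [totalCost]
  have hn : ∫ ω in alive I B n, totalCost I n ω ∂law Q ≤ B * (law Q).real (alive I B n) := by
    have := setIntegral_mono_on (integrable_totalCost Q hI hX n).integrableOn
      (integrable_const B).integrableOn (measurableSet_alive hI B n)
      fun ω hω => totalCost_le_of_alive hω
    rwa [setIntegral_const, smul_eq_mul, mul_comm] at this
  rw [h0]
  linarith

end BudgetBandit

end

/-! ### Wald's identity, and the regret in terms of pulls within the budget. -/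

noncomputable section

namespace BudgetBandit

variable {K : ℕ}

/-- The hypothesis excludes the default `sInf ∅ = 0`. The total cost need not be monotone, which is
why `alive` constrains all prefixes. -/
lemma lt_numPulls_iff {I : ℕ → Outcome K → Fin K} {B : ℝ} {ω : Outcome K}
    (h : ∃ n, ω ∉ alive I B n) (i : ℕ) : i < numPulls I B ω ↔ ω ∈ alive I B i := by
  have hne : {n : ℕ | B < totalCost I n ω}.Nonempty := by
    obtain ⟨n, hn⟩ := h
    simp only [alive, Set.mem_ofPred_eq, not_forall, not_le] at hn
    obtain ⟨j, _, hj⟩ := hn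
    exact ⟨j, hj⟩
  constructor
  · intro hi j hj
    by_contra! hlt
    exact absurd (Nat.sInf_le hlt) (not_le.2 (lt_of_le_of_lt hj hi))
  · intro hi
    by_contra! hle
    exact absurd (hi _ hle) (not_le.2 (Nat.sInf_mem hne))

lemma lt_totalCost_numPulls {I : ℕ → Outcome K → Fin K} {B : ℝ} {ω : Outcome K}
    (h : ∃ n, ω ∉ alive I B n) : B < totalCost I (numPulls I B ω) ω := by
  by_contra! hle
  have h0 := (lt_numPulls_iff h (numPulls I B ω)).not.1 (lt_irrefl _)
  refine h0 fun j hj => ?_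
  rcases hj.lt_or_eq with hj | rfl
  · exact ((lt_numPulls_iff h j).1 hj) j le_rfl
  · exact hle

lemma hasSum_numPulls {I : ℕ → Outcome K → Fin K} {B : ℝ} {ω : Outcome K}
    (h : ∃ n, ω ∉ alive I B n) (g : ℕ → Outcome K → ℝ) :
    HasSum (fun i => (alive I B i).indicator (g i) ω)
      (∑ i ∈ Finset.range (numPulls I B ω), g i ω) := by
  have e : ∑ i ∈ Finset.range (numPulls I B ω), g i ω =
      ∑ i ∈ Finset.range (numPulls I B ω), (alive I B i).indicator (g i) ω :=
    Finset.sum_congr rfl fun i hi => by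
      rw [Set.indicator_of_mem ((lt_numPulls_iff h i).1 (Finset.mem_range.1 hi))]
  rw [e]
  refine hasSum_sum_of_ne_finset_zero fun i hi => ?_
  rw [Set.indicator_of_notMem]
  rwa [← lt_numPulls_iff h i, ← Finset.mem_range]

variable (Q : Fin K → Measure (ℝ × ℝ)) [∀ k, IsProbabilityMeasure (Q k)]

/-- The probability that epoch `i` is within budget and pulls arm `k`. -/
def pullProb (I : ℕ → Outcome K → Fin K) (B : ℝ) (i : ℕ) (k : Fin K) : ℝ :=
  (law Q).real (alive I B i ∩ {ω | I i ω = k})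

/-- The expected number of pulls of arm `k` within the budget. -/
def budgetPulls (I : ℕ → Outcome K → Fin K) (B : ℝ) (k : Fin K) : ℝ :=
  ∑' i, pullProb Q I B i k

lemma pullProb_nonneg (I : ℕ → Outcome K → Fin K) (B : ℝ) (i : ℕ) (k : Fin K) :
    0 ≤ pullProb Q I B i k := measureReal_nonneg

lemma sum_pullProb {I : ℕ → Outcome K → Fin K} (hI : Admissible I) (B : ℝ) (i : ℕ) :
    ∑ k, pullProb Q I B i k = (law Q).real (alive I B i) := by
  have := setIntegral_obs Q hI (measurableSet_alive_history I B i) (f := fun _ => 1)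
    measurable_const (fun _ => integrable_const _)
  simpa [pullProb] using this.symm

section Wald

variable {I : ℕ → Outcome K → Fin K} (hI : Admissible I)
  (hX : ∀ k, Integrable (fun z : ℝ × ℝ => z.1) (Q k)) (hpos : ∀ k, 0 < meanCost (Q k))
  {B C : ℝ} (hC : ∀ n, ∑ i ∈ Finset.range n, ∫ ω in alive I B i, (obs I i ω).1 ∂law Q ≤ B + C)

include hI hX hC

lemma sum_range_pullProb_le (n : ℕ) :
    ∑ i ∈ Finset.range n, ∑ k, pullProb Q I B i k * meanCost (Q k) ≤ B + C := by
  refine le_of_eq_of_le (Finset.sum_congr rfl fun i _ => ?_) (hC n)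
  exact (setIntegral_obs Q hI (measurableSet_alive_history I B i) measurable_fst hX).symm

include hpos

/-- Each pull has positive expected cost, so bounded expected cost bounds the expected number of
pulls. -/
lemma summable_pullProb (k : Fin K) : Summable (fun i => pullProb Q I B i k) := by
  refine summable_of_sum_range_le (c := (B + C) / meanCost (Q k))
    (fun i => pullProb_nonneg Q I B i k) fun n => ?_
  rw [le_div_iff₀ (hpos k), Finset.sum_mul]
  refine le_trans (Finset.sum_le_sum fun i _ => ?_) (sum_range_pullProb_le Q hI hX hC n)
  exact Finset.single_le_sum (f := fun k => pullProb Q I B i k * meanCost (Q k))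
    (fun j _ => mul_nonneg (pullProb_nonneg Q I B i j) (hpos j).le) (Finset.mem_univ k)

lemma hasSum_budgetPulls_mul (c : Fin K → ℝ) :
    HasSum (fun i => ∑ k, pullProb Q I B i k * c k) (∑ k, budgetPulls Q I B k * c k) :=
  hasSum_sum fun k _ => ((summable_pullProb Q hI hX hpos hC k).hasSum).mul_right (c k)

lemma sum_budgetPulls_le : ∑ k, budgetPulls Q I B k * meanCost (Q k) ≤ B + C :=
  le_of_tendsto' (hasSum_budgetPulls_mul Q hI hX hpos hC _).tendsto_sum_nat
    fun n => sum_range_pullProb_le Q hI hX hC n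

/-- The expected number of epochs within budget is finite, so the probability of being within budget
tends to zero. -/
lemma ae_exists_not_alive : ∀ᵐ ω ∂law Q, ∃ n, ω ∉ alive I B n := by
  have hsum : Summable fun i => (law Q).real (alive I B i) := by
    have := (hasSum_budgetPulls_mul Q hI hX hpos hC (fun _ => 1)).summable
    simpa [sum_pullProb Q hI] using this
  have h0 : (law Q).real {ω | ¬ ∃ n, ω ∉ alive I B n} ≤ 0 := by
    refine ge_of_tendsto' hsum.tendsto_atTop_zero fun n => ?_
    refine measureReal_mono fun ω hω => ?_
    simp only [Set.mem_ofPred_eq, not_exists, not_not] at hω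
    exact hω n
  rw [ae_iff]
  exact (measureReal_eq_zero_iff).1 (le_antisymm h0 measureReal_nonneg)

/-- Wald's identity. -/
lemma integral_sum_range_numPulls {f : ℝ × ℝ → ℝ} (hfm : Measurable f)
    (hf : ∀ k, Integrable f (Q k)) :
    Integrable (fun ω => ∑ i ∈ Finset.range (numPulls I B ω), f (obs I i ω)) (law Q) ∧
    ∫ ω, ∑ i ∈ Finset.range (numPulls I B ω), f (obs I i ω) ∂law Q =
      ∑ k, budgetPulls Q I B k * ∫ z, f z ∂Q k := by
  -- The random sum becomes a series with deterministic range; its `L¹` norms are summable, so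
  -- expectation and series can be exchanged.
  set F : ℕ → Outcome K → ℝ := fun i => (alive I B i).indicator (fun ω => f (obs I i ω)) with hF
  have hFi : ∀ i, Integrable (F i) (law Q) := fun i =>
    (integrable_obs Q hI i hf).indicator (measurableSet_alive hI B i)
  have hstep : ∀ g : ℝ × ℝ → ℝ, Measurable g → (∀ k, Integrable g (Q k)) → ∀ i,
      ∫ ω in alive I B i, g (obs I i ω) ∂law Q = ∑ k, pullProb Q I B i k * ∫ z, g z ∂Q k :=
    fun g hgm hg i => setIntegral_obs Q hI (measurableSet_alive_history I B i) hgm hg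
  have hnorm : ∀ i, ∫ ω, ‖F i ω‖ ∂law Q = ∑ k, pullProb Q I B i k * ∫ z, |f z| ∂Q k := by
    intro i
    rw [← hstep _ hfm.abs (fun k => (hf k).abs), ← integral_indicator (measurableSet_alive hI B i)]
    refine integral_congr_ae (Eventually.of_forall fun ω => ?_)
    simp only [hF, norm_indicator_eq_indicator_norm, Real.norm_eq_abs]
  have hsum : Summable fun i => ∫ ω, ‖F i ω‖ ∂law Q := by
    simp only [hnorm]
    exact (hasSum_budgetPulls_mul Q hI hX hpos hC _).summable
  have hae : ∀ᵐ ω ∂law Q, HasSum (fun i => F i ω)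
      (∑ i ∈ Finset.range (numPulls I B ω), f (obs I i ω)) := by
    filter_upwards [ae_exists_not_alive Q hI hX hpos hC] with ω hω
    exact hasSum_numPulls hω fun i ω => f (obs I i ω)
  refine ⟨⟨?_, ?_⟩, ?_⟩
  · refine aestronglyMeasurable_of_tendsto_ae atTop
      (f := fun n ω => ∑ i ∈ Finset.range n, F i ω) (fun n => ?_) ?_
    · exact (integrable_finsetSum _ fun i _ => hFi i).aestronglyMeasurable
    · filter_upwards [hae] with ω hω using hω.tendsto_sum_nat
  · have h1 : ∫⁻ ω, ‖∑ i ∈ Finset.range (numPulls I B ω), f (obs I i ω)‖ₑ ∂law Q ≤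
        ∫⁻ ω, ∑' i, ‖F i ω‖ₑ ∂law Q := by
      refine lintegral_mono_ae ?_
      filter_upwards [hae] with ω hω
      rw [← hω.tsum_eq]
      exact enorm_tsum_le_tsum_enorm
    refine h1.trans_lt ?_
    rw [lintegral_tsum fun i => (hFi i).aestronglyMeasurable.enorm]
    simp only [← fun i => ofReal_integral_norm_eq_lintegral_enorm (hFi i)]
    rw [← ENNReal.ofReal_tsum_of_nonneg (fun i => integral_nonneg fun ω => norm_nonneg _) hsum]
    exact ENNReal.ofReal_lt_top
  · have e : ∫ ω, ∑ i ∈ Finset.range (numPulls I B ω), f (obs I i ω) ∂law Q =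
        ∫ ω, ∑' i, F i ω ∂law Q :=
      integral_congr_ae (by filter_upwards [hae] with ω hω using hω.tsum_eq.symm)
    rw [e]
    refine (hasSum_integral_of_summable_integral_norm hFi hsum).unique ?_
    simp only [hF, integral_indicator (measurableSet_alive hI B _), hstep f hfm hf]
    exact hasSum_budgetPulls_mul Q hI hX hpos hC _

/-- At the stopping time the total cost exceeds `B`; take expectations by Wald. With
`sum_budgetPulls_le` this confines the expected cost of any policy to `[B, B + C]`. -/
lemma le_sum_budgetPulls : B ≤ ∑ k, budgetPulls Q I B k * meanCost (Q k) := by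
  obtain ⟨hi, he⟩ := integral_sum_range_numPulls Q hI hX hpos hC measurable_fst hX
  have h1 : ∫ _ω, B ∂law Q ≤ ∫ ω, ∑ i ∈ Finset.range (numPulls I B ω), (obs I i ω).1 ∂law Q := by
    refine integral_mono_ae (integrable_const B) hi ?_
    filter_upwards [ae_exists_not_alive Q hI hX hpos hC] with ω hω
    exact (lt_totalCost_numPulls hω).le
  rw [he] at h1
  simpa [meanCost] using h1

/-- Wald for the rewards, with mean reward `(r* - Δ_k) * E[X]` for arm `k`. -/
lemma expReward_eq (hR : ∀ k, Integrable (fun z : ℝ × ℝ => z.2) (Q k)) :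
    expReward Q I B =
      optRate Q * ∑ k, budgetPulls Q I B k * meanCost (Q k) -
        ∑ k, meanCost (Q k) * gap Q k * budgetPulls Q I B k := by
  have he := (integral_sum_range_numPulls Q hI hX hpos hC measurable_snd hR).2
  rw [show expReward Q I B = ∫ ω, ∑ i ∈ Finset.range (numPulls I B ω), (obs I i ω).2 ∂law Q from
    rfl, he, Finset.mul_sum, ← Finset.sum_sub_distrib]
  refine Finset.sum_congr rfl fun k _ => ?_
  have : ∫ z, z.2 ∂Q k = rate (Q k) * meanCost (Q k) :=
    (div_mul_cancel₀ _ (hpos k).ne').symm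
  rw [this, gap]; ring

end Wald

lemma admissible_const (k : Fin K) : Admissible (fun _ _ => k : ℕ → Outcome K → Fin K) := by
  intro n l
  exact @MeasurableSet.const _ (history _ n) _

lemma budgetPulls_const_of_ne {k l : Fin K} (h : l ≠ k) (B : ℝ) :
    budgetPulls Q (fun _ _ => k) B l = 0 := by
  simp [budgetPulls, pullProb, h.symm]

/-- The regret is at least the cost of the pulls of suboptimal arms, up to a constant. -/
lemma le_regret [NeZero K] {I : ℕ → Outcome K → Fin K} (hI : Admissible I)
    (hX : ∀ k, Integrable (fun z : ℝ × ℝ => z.1) (Q k))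
    (hR : ∀ k, Integrable (fun z : ℝ × ℝ => z.2) (Q k)) (hpos : ∀ k, 0 < meanCost (Q k))
    {B C : ℝ}
    (hC : ∀ J : ℕ → Outcome K → Fin K, Admissible J → ∀ n,
      ∑ i ∈ Finset.range n, ∫ ω in alive J B i, (obs J i ω).1 ∂law Q ≤ B + C) :
    ((∑ k, meanCost (Q k) * gap Q k * budgetPulls Q I B k - |optRate Q| * C : ℝ) : EReal) ≤
      regret Q I B := by
  -- The competitor in the supremum pulls one best arm forever; it has no gap term.
  obtain ⟨k, hk⟩ := exists_eq_ciSup_of_finite (f := fun k => rate (Q k))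
  have hJ := admissible_const k
  have hgap : gap Q k = 0 := sub_eq_zero.2 hk.symm
  have h0 : ∑ l, meanCost (Q l) * gap Q l * budgetPulls Q (fun _ _ => k) B l = 0 := by
    refine Finset.sum_eq_zero fun l _ => ?_
    by_cases h : l = k
    · rw [h, hgap]; ring
    · rw [budgetPulls_const_of_ne Q h]; ring
  have e1 := expReward_eq Q hJ hX hpos (hC _ hJ) hR
  have e2 := expReward_eq Q hI hX hpos (hC _ hI) hR
  have b1 := le_sum_budgetPulls Q hJ hX hpos (hC _ hJ)
  have b2 := le_sum_budgetPulls Q hI hX hpos (hC _ hI)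
  have b3 := sum_budgetPulls_le Q hJ hX hpos (hC _ hJ)
  have b4 := sum_budgetPulls_le Q hI hX hpos (hC _ hI)
  rw [h0, sub_zero] at e1
  set s1 := ∑ l, budgetPulls Q (fun _ _ => k) B l * meanCost (Q l)
  set s2 := ∑ l, budgetPulls Q I B l * meanCost (Q l)
  have habs : -(|optRate Q| * C) ≤ optRate Q * (s1 - s2) := by
    have h1 : |s1 - s2| ≤ C := abs_le.2 ⟨by linarith, by linarith⟩
    have h2 := neg_abs_le (optRate Q * (s1 - s2))
    rw [abs_mul] at h2
    have h3 := mul_le_mul_of_nonneg_left h1 (abs_nonneg (optRate Q))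
    linarith
  have hreal : ∑ k, meanCost (Q k) * gap Q k * budgetPulls Q I B k - |optRate Q| * C ≤
      expReward Q (fun _ _ => k) B - expReward Q I B := by
    rw [e1, e2]; linarith
  refine (EReal.coe_le_coe_iff.2 hreal).trans ?_
  rw [EReal.coe_sub]
  exact EReal.sub_le_sub (le_iSup (fun J : {J : ℕ → Outcome K → Fin K // Admissible J} =>
    (expReward Q J.1 B : EReal)) ⟨_, hJ⟩) le_rfl

/-- Within budget `B`, an arm is pulled about as often as in the first `n ≤ √B` epochs. -/
lemma le_budgetPulls {I : ℕ → Outcome K → Fin K} (hI : Admissible I)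
    (hX : ∀ k, Integrable (fun z : ℝ × ℝ => z.1) (Q k)) (hpos : ∀ k, 0 < meanCost (Q k))
    {B C : ℝ} (hB : 0 < B)
    (hC : ∀ n, ∑ i ∈ Finset.range n, ∫ ω in alive I B i, (obs I i ω).1 ∂law Q ≤ B + C)
    (k : Fin K) {n : ℕ} (hn : (n : ℝ) ^ 2 ≤ B) :
    ∫ ω, (pullCount I k n ω : ℝ) ∂law Q - ∑ l, ∫ z, |z.1| ∂Q l ≤ budgetPulls Q I B k := by
  set M := ∑ l, ∫ z, |z.1| ∂Q l with hM
  have hM0 : 0 ≤ M := Finset.sum_nonneg fun l _ => integral_nonneg fun z => abs_nonneg _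
  have hcost : ∀ i, ∫ ω, |(obs I i ω).1| ∂law Q ≤ M := by
    intro i
    have := setIntegral_obs Q hI (n := i) MeasurableSet.univ (f := fun z => |z.1|)
      (by fun_prop) (fun k => (hX k).abs)
    rw [setIntegral_univ] at this
    rw [this]
    refine Finset.sum_le_sum fun l _ => ?_
    have h1 : (law Q).real (Set.univ ∩ {ω | I i ω = l}) ≤ 1 := measureReal_le_one
    exact mul_le_of_le_one_left (integral_nonneg fun z => abs_nonneg _) h1
  have hdead : ∀ i ≤ n, B * (law Q).real (alive I B i)ᶜ ≤ n * M := by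
    intro i hi
    have hint : Integrable (fun ω => ∑ j ∈ Finset.range n, |(obs I j ω).1|) (law Q) :=
      integrable_finsetSum _ fun j _ => (integrable_obs Q hI j hX).abs
    -- With signed costs, an early exit is controlled through the sum of absolute costs, to which
    -- Markov's inequality applies.
    have hsub : (alive I B i)ᶜ ⊆ {ω | B ≤ ∑ j ∈ Finset.range n, |(obs I j ω).1|} := by
      intro ω hω
      simp only [alive, Set.mem_compl_iff, Set.mem_ofPred_eq, not_forall, not_le] at hω
      obtain ⟨j, hj, hlt⟩ := hω
      refine hlt.le.trans ((Finset.sum_le_sum fun _ _ => le_abs_self _).trans ?_)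
      exact Finset.sum_le_sum_of_subset_of_nonneg
        (Finset.range_mono (hj.trans hi)) fun _ _ _ => abs_nonneg _
    have hmk := mul_meas_ge_le_integral_of_nonneg
      (Eventually.of_forall fun ω => Finset.sum_nonneg fun _ _ => abs_nonneg _) hint B
    rw [integral_finsetSum _ fun j _ => (integrable_obs Q hI j hX).abs] at hmk
    calc B * (law Q).real (alive I B i)ᶜ
        ≤ B * (law Q).real {ω | B ≤ ∑ j ∈ Finset.range n, |(obs I j ω).1|} :=
          mul_le_mul_of_nonneg_left (measureReal_mono hsub) hB.le
      _ ≤ ∑ j ∈ Finset.range n, ∫ ω, |(obs I j ω).1| ∂law Q := hmk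
      _ ≤ ∑ j ∈ Finset.range n, M := Finset.sum_le_sum fun j _ => hcost j
      _ = n * M := by simp
  have hterm : ∀ i ∈ Finset.range n,
      (law Q).real {ω | I i ω = k} - n * M / B ≤ pullProb Q I B i k := by
    intro i hi
    have h1 : (law Q).real {ω | I i ω = k} ≤
        pullProb Q I B i k + (law Q).real (alive I B i)ᶜ := by
      refine (measureReal_mono (fun ω hω => ?_)).trans (measureReal_union_le _ _)
      by_cases h : ω ∈ alive I B i
      · exact Or.inl ⟨h, hω⟩
      · exact Or.inr h
    have h2 : (law Q).real (alive I B i)ᶜ ≤ n * M / B := by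
      rw [le_div_iff₀ hB, mul_comm]
      exact hdead i (Finset.mem_range.1 hi).le
    linarith
  have h3 := Finset.sum_le_sum hterm
  rw [Finset.sum_sub_distrib, ← integral_pullCount Q hI] at h3
  have h4 : ∑ i ∈ Finset.range n, pullProb Q I B i k ≤ budgetPulls Q I B k :=
    (summable_pullProb Q hI hX hpos hC k).sum_le_tsum _ fun i _ => pullProb_nonneg Q I B i k
  -- Each of `n` epochs loses at most `n * M / B`; the total stays bounded precisely because `n ^ 2
  -- ≤ B`.
  have h5 : ∑ _i ∈ Finset.range n, n * M / B ≤ M := by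
    rw [Finset.sum_const, Finset.card_range, nsmul_eq_mul, ← mul_div_assoc, div_le_iff₀ hB]
    nlinarith
  linarith

end BudgetBandit

end

/-! ### Change of measure and the information inequality. -/

noncomputable section

namespace BudgetBandit

/-- Two finite measures that agree on the rectangles of two maps agree on the σ-algebra that the
maps generate. -/
lemma measure_eq_of_inter_preimage {Ω E F : Type*} [MeasurableSpace Ω] [mE : MeasurableSpace E]
    [mF : MeasurableSpace F] {μ ν : Measure Ω} [IsFiniteMeasure μ] {X : Ω → E} {Y : Ω → F}
    (hX : Measurable X) (hY : Measurable Y)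
    (h : ∀ s t, MeasurableSet s → MeasurableSet t → μ (X ⁻¹' s ∩ Y ⁻¹' t) = ν (X ⁻¹' s ∩ Y ⁻¹' t))
    {u : Set Ω} (hu : MeasurableSet[mE.comap X ⊔ mF.comap Y] u) : μ u = ν u := by
  have hXY := hX.prodMk hY
  have e : μ.map (fun ω => (X ω, Y ω)) = ν.map (fun ω => (X ω, Y ω)) := by
    refine Measure.ext_prod fun {s t} hs ht => ?_
    rw [Measure.map_apply hXY (hs.prod ht), Measure.map_apply hXY (hs.prod ht)]
    exact h s t hs ht
  rw [← MeasurableSpace.comap_prodMk] at hu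
  obtain ⟨v, hv, rfl⟩ := hu
  rw [← Measure.map_apply hXY hv, e, Measure.map_apply hXY hv]

variable {K : ℕ}

/-- The `comap id` fits `measure_eq_of_inter_preimage`, with the identity as a map into the outcomes
equipped with the coarser σ-algebra. -/
lemma history_succ (I : ℕ → Outcome K → Fin K) (n : ℕ) :
    history I (n + 1) =
      (history I n).comap id ⊔ MeasurableSpace.comap (obs I n) inferInstance := by
  rw [MeasurableSpace.comap_id, history, Finset.range_add_one, Finset.iSup_insert, sup_comm]

variable (Q Q' : Fin K → Measure (ℝ × ℝ))

/-- The likelihood ratio of one observation, for instances that differ in arm `k` only. -/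
def armRatio (k l : Fin K) (z : ℝ × ℝ) : ℝ≥0∞ := if l = k then (Q k).rnDeriv (Q' k) z else 1

lemma measurable_armRatio (k : Fin K) :
    Measurable fun p : Fin K × (ℝ × ℝ) => armRatio Q Q' k p.1 p.2 := by
  refine measurable_from_prod_countable_right fun l => ?_
  unfold armRatio
  by_cases h : l = k
  · simpa [h] using Measure.measurable_rnDeriv _ _
  · simp [h]

/-- The likelihood ratio of the first `n` observations. -/
def likelihood (I : ℕ → Outcome K → Fin K) (k : Fin K) (n : ℕ) (ω : Outcome K) : ℝ≥0∞ :=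
  ∏ i ∈ Finset.range n, armRatio Q Q' k (I i ω) (obs I i ω)

lemma measurable_likelihood {I : ℕ → Outcome K → Fin K} (hI : Admissible I) (k : Fin K) (n : ℕ) :
    Measurable[history I n] (likelihood Q Q' I k n) := by
  unfold likelihood
  refine Finset.measurable_fun_prod _ fun i hi => ?_
  have hi : i < n := Finset.mem_range.1 hi
  refine (measurable_armRatio Q Q' k).comp (Measurable.prodMk ?_ (measurable_obs_history I hi))
  exact (measurable_arm_history hI i).mono (history_mono I hi.le) le_rfl

variable [∀ k, IsProbabilityMeasure (Q k)] [∀ k, IsProbabilityMeasure (Q' k)]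

variable {Q Q'} in
lemma setLIntegral_armRatio {k : Fin K} (hQ : ∀ l, l ≠ k → Q l = Q' l) (hac : Q k ≪ Q' k)
    (l : Fin K) (t : Set (ℝ × ℝ)) : ∫⁻ z in t, armRatio Q Q' k l z ∂Q' l = Q l t := by
  by_cases h : l = k
  · subst h
    simp [armRatio, Measure.setLIntegral_rnDeriv hac]
  · simp [armRatio, h, hQ l h]

variable {Q Q'} in
/-- Change of measure between instances that differ in arm `k` only. -/
lemma lintegral_eq_lintegral_mul_likelihood {I : ℕ → Outcome K → Fin K} (hI : Admissible I)
    {k : Fin K} (hQ : ∀ l, l ≠ k → Q l = Q' l) (hac : Q k ≪ Q' k) (n : ℕ)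
    {G : Outcome K → ℝ≥0∞} (hG : Measurable[history I n] G) :
    ∫⁻ ω, G ω ∂law Q = ∫⁻ ω, G ω * likelihood Q Q' I k n ω ∂law Q' := by
  induction n generalizing G with
  | zero =>
    -- Before any observation the history is trivial, so `G` is constant.
    have hbot : history I 0 = ⊥ := by simp [history]
    rw [hbot] at hG
    obtain ⟨c, rfl⟩ : ∃ c, G = fun _ => c := by
      refine ⟨G fun _ => 0, funext fun ω => ?_⟩
      have h := hG (measurableSet_singleton (G fun _ => 0))
      rcases MeasurableSpace.measurableSet_bot_iff.1 h with h | h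
      · exact absurd (Set.mem_singleton (G fun _ => 0)) (Set.eq_empty_iff_forall_notMem.1 h _)
      · exact Set.eq_univ_iff_forall.1 h ω
    simp [likelihood]
  | succ n ih =>
    have hLm : ∀ m, Measurable (likelihood Q Q' I k m) := fun m =>
      (measurable_likelihood Q Q' hI k m).mono (history_le hI m) le_rfl
    have hset : ∀ u, MeasurableSet[history I (n + 1)] u →
        law Q u = (law Q').withDensity (likelihood Q Q' I k (n + 1)) u := by
      intro u hu
      rw [history_succ] at hu
      have hid : @Measurable _ _ inferInstance (history I n) (id : Outcome K → Outcome K) :=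
        measurable_id.mono le_rfl (history_le hI n)
      refine @measure_eq_of_inter_preimage (Outcome K) (Outcome K) (ℝ × ℝ) _ (history I n) _ _ _ _
        id (obs I n) hid (measurable_obs hI n) (fun s t hs ht => ?_) u hu
      rw [Set.preimage_id]
      have hsm := history_le hI n _ hs
      have htm := measurable_obs hI n ht
      have hY : Measurable[history I n] (s.indicator (fun _ => (1 : ℝ≥0∞))) :=
        (@measurable_const _ _ _ (history I n) (1 : ℝ≥0∞)).indicator hs
      have hL := measurable_likelihood Q Q' hI k n
      have hQt : Measurable[history I n] fun ω => Q (I n ω) t :=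
        (measurable_of_countable fun l => Q l t).comp (measurable_arm_history hI n)
      have hr : Measurable fun p : (Fin K × ℝ≥0∞) × (ℝ × ℝ) => armRatio Q Q' k p.1.1 p.2 :=
        (measurable_armRatio Q Q' k).comp
          ((measurable_fst.comp measurable_fst).prodMk measurable_snd)
      have h1t : Measurable (t.indicator (fun _ => (1 : ℝ≥0∞))) := measurable_const.indicator ht
      have e1 : law Q (s ∩ obs I n ⁻¹' t) =
          ∫⁻ ω, s.indicator (fun _ => (1 : ℝ≥0∞)) ω * Q (I n ω) t ∂law Q := by
        have := lintegral_arm_obs Q hI hY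
          (f := fun p => p.1.2 * t.indicator (fun _ => (1 : ℝ≥0∞)) p.2) (by fun_prop)
        simp only [lintegral_const_mul _ h1t, lintegral_indicator_const ht, one_mul] at this
        rw [← this, ← lintegral_indicator_one (hsm.inter htm)]
        refine lintegral_congr fun ω => ?_
        by_cases h1 : ω ∈ s <;> by_cases h2 : obs I n ω ∈ t <;>
          simp [h1, h2]
      have hYL : Measurable[history I n]
          fun ω => s.indicator (fun _ => (1 : ℝ≥0∞)) ω * likelihood Q Q' I k n ω := hY.mul hL
      have e2 := lintegral_arm_obs Q' hI hYL
        (f := fun p => p.1.2 * (t.indicator (fun _ => (1 : ℝ≥0∞)) p.2 *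
          armRatio Q Q' k p.1.1 p.2)) (by fun_prop)
      have e3 : ∀ l, ∫⁻ z, t.indicator (fun _ => (1 : ℝ≥0∞)) z * armRatio Q Q' k l z ∂Q' l =
          Q l t := by
        intro l
        rw [← setLIntegral_armRatio hQ hac l t, ← lintegral_indicator ht]
        refine lintegral_congr fun z => ?_
        by_cases h : z ∈ t <;> simp [h]
      have hl : ∀ l, Measurable fun z =>
          t.indicator (fun _ => (1 : ℝ≥0∞)) z * armRatio Q Q' k l z := fun l =>
        h1t.mul ((measurable_armRatio Q Q' k).comp (measurable_const.prodMk measurable_id))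
      simp only [lintegral_const_mul _ (hl _), e3] at e2
      -- The induction hypothesis is applied to this conditional probability of the rectangle; `e3`
      -- then turns `Q (I n ω) t` into an integral of the new likelihood factor under `Q'`.
      have hYQ : Measurable[history I n]
          fun ω => s.indicator (fun _ => (1 : ℝ≥0∞)) ω * Q (I n ω) t := hY.mul hQt
      rw [e1, ih hYQ, withDensity_apply _ (hsm.inter htm),
        ← lintegral_indicator (hsm.inter htm)]
      refine Eq.trans (lintegral_congr fun ω => ?_) (e2.symm.trans (lintegral_congr fun ω => ?_))
      · ring
      · have : likelihood Q Q' I k (n + 1) ω =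
            likelihood Q Q' I k n ω * armRatio Q Q' k (I n ω) (obs I n ω) :=
          Finset.prod_range_succ _ _
        by_cases h1 : ω ∈ s <;> by_cases h2 : obs I n ω ∈ t <;>
          simp [h1, h2, this]
    have hle := history_le hI (n + 1)
    have htrim : (law Q).trim hle =
        ((law Q').withDensity (likelihood Q Q' I k (n + 1))).trim hle := by
      refine @Measure.ext _ (history I (n + 1)) _ _ fun u hu => ?_
      rw [trim_measurableSet_eq hle hu, trim_measurableSet_eq hle hu, hset u hu]
    rw [← lintegral_trim hle hG, htrim, lintegral_trim hle hG,
      lintegral_withDensity_eq_lintegral_mul _ (hLm (n + 1)) (hG.mono hle le_rfl)]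
    simp only [Pi.mul_apply, mul_comm]

variable {Q Q'} in
/-- The information inequality (in its Donsker-Varadhan form) for the observations of a bandit. -/
lemma le_integral_pullCount_mul {I : ℕ → Outcome K → Fin K} (hI : Admissible I)
    {k : Fin K} (hQ : ∀ l, l ≠ k → Q l = Q' l) (hac : Q k ≪ Q' k)
    (hllr : Integrable (llr (Q k) (Q' k)) (Q k)) (n : ℕ)
    {g : Outcome K → ℝ} (hg : Measurable[history I n] g) (hgi : Integrable g (law Q))
    (hge : Integrable (fun ω => Real.exp (g ω)) (law Q')) :
    1 + ∫ ω, g ω ∂law Q - ∫ ω, Real.exp (g ω) ∂law Q' ≤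
      (∫ ω, (pullCount I k n ω : ℝ) ∂law Q) * ∫ z, llr (Q k) (Q' k) z ∂Q k := by
  set f : Fin K → ℝ × ℝ → ℝ := fun l z => if l = k then llr (Q k) (Q' k) z else 0 with hf
  have hfm : ∀ l, Measurable (f l) := by
    intro l
    by_cases h : l = k
    · simpa [hf, h] using measurable_llr _ _
    · simp [hf, h]
  have hfi : ∀ l, Integrable (f l) (Q l) := by
    intro l
    by_cases h : l = k
    · subst h; simpa [hf] using hllr
    · simp [hf, h]
  set Λ : Outcome K → ℝ := fun ω => ∑ i ∈ Finset.range n, f (I i ω) (obs I i ω) with hΛ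
  have hΛi : Integrable Λ (law Q) := integrable_finsetSum _ fun i _ => integrable_arm_obs Q hI i hfi
  have hΛval : ∫ ω, Λ ω ∂law Q =
      (∫ ω, (pullCount I k n ω : ℝ) ∂law Q) * ∫ z, llr (Q k) (Q' k) z ∂Q k := by
    rw [hΛ, integral_finsetSum _ fun i _ => integrable_arm_obs Q hI i hfi,
      integral_pullCount Q hI, Finset.sum_mul]
    refine Finset.sum_congr rfl fun i _ => ?_
    rw [← setIntegral_univ, setIntegral_arm_obs Q hI MeasurableSet.univ hfm hfi,
      Finset.sum_eq_single k]
    · simp [hf]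
    · intro l _ hl; simp [hf, hl]
    · simp
  have hae : ∀ᵐ ω ∂law Q, (likelihood Q Q' I k n ω)⁻¹ = ENNReal.ofReal (Real.exp (-Λ ω)) := by
    have h1 : ∀ l, ∀ᵐ z ∂Q l, armRatio Q Q' k l z = ENNReal.ofReal (Real.exp (f l z)) := by
      intro l
      by_cases h : l = k
      · subst h
        filter_upwards [Measure.rnDeriv_pos hac, hac (Measure.rnDeriv_lt_top (Q l) (Q' l))]
          with z hz1 hz2
        simp only [armRatio, hf, if_true, llr_def]
        rw [Real.exp_log (ENNReal.toReal_pos hz1.ne' hz2.ne), ENNReal.ofReal_toReal hz2.ne]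
      · simp [armRatio, hf, h]
    have h2 : ∀ᵐ ω ∂law Q, ∀ i, armRatio Q Q' k (I i ω) (obs I i ω) =
        ENNReal.ofReal (Real.exp (f (I i ω) (obs I i ω))) :=
      ae_all_iff.2 fun i => ae_arm_obs Q i h1
    filter_upwards [h2] with ω hω
    rw [likelihood, Finset.prod_congr rfl fun i _ => hω i,
      ← ENNReal.ofReal_prod_of_nonneg fun i _ => (Real.exp_pos _).le, ← Real.exp_sum,
      ← ENNReal.ofReal_inv_of_pos (Real.exp_pos _), ← Real.exp_neg]
  have hgm : Measurable g := hg.mono (history_le hI n) le_rfl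
  have hL := measurable_likelihood Q Q' hI k n
  -- Only an inequality: the likelihood may vanish with positive probability under `Q'`, where its
  -- product with its inverse is `0`.
  have hle : ∫⁻ ω, ENNReal.ofReal (Real.exp (g ω - Λ ω)) ∂law Q ≤
      ∫⁻ ω, ENNReal.ofReal (Real.exp (g ω)) ∂law Q' := by
    have e1 : ∫⁻ ω, ENNReal.ofReal (Real.exp (g ω - Λ ω)) ∂law Q =
        ∫⁻ ω, ENNReal.ofReal (Real.exp (g ω)) * (likelihood Q Q' I k n ω)⁻¹ ∂law Q := by
      refine lintegral_congr_ae ?_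
      filter_upwards [hae] with ω hω
      rw [hω, ← ENNReal.ofReal_mul (Real.exp_pos _).le, ← Real.exp_add, sub_eq_add_neg]
    have hGm : Measurable[history I n]
        fun ω => ENNReal.ofReal (Real.exp (g ω)) * (likelihood Q Q' I k n ω)⁻¹ :=
      (ENNReal.measurable_ofReal.comp (Real.measurable_exp.comp hg)).mul hL.inv
    rw [e1, lintegral_eq_lintegral_mul_likelihood hI hQ hac n hGm]
    refine lintegral_mono fun ω => ?_
    rw [mul_assoc, mul_comm (likelihood Q Q' I k n ω)⁻¹]
    exact mul_le_of_le_one_right' (ENNReal.mul_inv_le_one _)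
  have hfin : ∫⁻ ω, ENNReal.ofReal (Real.exp (g ω)) ∂law Q' ≠ ∞ :=
    (hge.lintegral_lt_top).ne
  have hei : Integrable (fun ω => Real.exp (g ω - Λ ω)) (law Q) := by
    refine (lintegral_ofReal_ne_top_iff_integrable
      (Real.continuous_exp.comp_aestronglyMeasurable (hgi.sub hΛi).aestronglyMeasurable)
      (Eventually.of_forall fun ω => (Real.exp_pos _).le)).1 (ne_top_of_le_ne_top hfin hle)
  -- The tangent bound `1 + x ≤ exp x` takes the place of Jensen's inequality.
  have h1 : ∫ ω, (1 + (g ω - Λ ω)) ∂law Q ≤ ∫ ω, Real.exp (g ω - Λ ω) ∂law Q := by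
    refine integral_mono ((integrable_const _).add (hgi.sub hΛi)) hei fun ω => ?_
    have := Real.add_one_le_exp (g ω - Λ ω)
    dsimp only
    linarith
  have h2 : ∫ ω, Real.exp (g ω - Λ ω) ∂law Q ≤ ∫ ω, Real.exp (g ω) ∂law Q' := by
    rw [integral_eq_lintegral_of_nonneg_ae (Eventually.of_forall fun ω => (Real.exp_pos _).le)
      hei.aestronglyMeasurable,
      integral_eq_lintegral_of_nonneg_ae (Eventually.of_forall fun ω => (Real.exp_pos _).le)
      hge.aestronglyMeasurable]
    exact ENNReal.toReal_mono hfin hle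
  have hsub : Integrable (fun ω => g ω - Λ ω) (law Q) := hgi.sub hΛi
  rw [integral_add (integrable_const _) hsub, integral_sub hgi hΛi] at h1
  simp only [integral_const, probReal_univ, smul_eq_mul, mul_one] at h1
  rw [← hΛval]
  linarith

end BudgetBandit

end

/-! ### The Lai-Robbins bound on the pulls of a suboptimal arm. -/

noncomputable section

namespace BudgetBandit

variable {K : ℕ}

lemma sum_pullCount (I : ℕ → Outcome K → Fin K) (n : ℕ) (ω : Outcome K) :
    ∑ k, pullCount I k n ω = n := by
  have := Finset.card_eq_sum_card_fiberwise (s := Finset.range n) (t := Finset.univ)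
    (f := fun i => I i ω) (fun _ _ => Finset.mem_coe.2 (Finset.mem_univ _))
  simpa [pullCount] using this.symm

lemma measurable_pullCount {I : ℕ → Outcome K → Fin K} (hI : Admissible I) (k : Fin K) (n : ℕ) :
    Measurable[history I n] fun ω => (pullCount I k n ω : ℝ) := by
  simp only [pullCount_eq_sum]
  refine Finset.measurable_fun_sum _ fun i hi => ?_
  exact (@measurable_const _ _ _ (history I n) (1 : ℝ)).indicator
    (history_mono I (Finset.mem_range.1 hi).le _ (hI i k))

lemma integrable_pullCount (Q : Fin K → Measure (ℝ × ℝ)) [∀ k, IsProbabilityMeasure (Q k)]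
    {I : ℕ → Outcome K → Fin K} (hI : Admissible I) (k : Fin K) (n : ℕ) :
    Integrable (fun ω => (pullCount I k n ω : ℝ)) (law Q) := by
  simp only [pullCount_eq_sum]
  exact integrable_finsetSum _ fun i _ =>
    (integrable_const _).indicator (history_le hI i _ (hI i k))

/-- The chord bound for the convex exponential. It makes an exponential moment linear in `x`, so
that consistency, a statement on means, controls it. -/
lemma exp_mul_le {x : ℝ} (h0 : 0 ≤ x) (h1 : x ≤ 1) (y : ℝ) :
    Real.exp (x * y) ≤ 1 + x * Real.exp y := by
  have := convexOn_exp.2 (Set.mem_univ y) (Set.mem_univ 0) h0 (sub_nonneg.2 h1) (by ring)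
  simp only [smul_eq_mul, mul_zero, add_zero, Real.exp_zero, mul_one] at this
  linarith

/-- A non-asymptotic lower bound on the pulls of an arm that is rarely pulled under `Q`, although
the other arms are rarely pulled under `Q'`. -/
lemma log_mul_le_integral_pullCount_mul {Q Q' : Fin K → Measure (ℝ × ℝ)}
    [∀ k, IsProbabilityMeasure (Q k)] [∀ k, IsProbabilityMeasure (Q' k)]
    {I : ℕ → Outcome K → Fin K} (hI : Admissible I) {k : Fin K}
    (hQ : ∀ l, l ≠ k → Q l = Q' l) (hac : Q k ≪ Q' k)
    (hllr : Integrable (llr (Q k) (Q' k)) (Q k)) {n : ℕ} (hn : 0 < n) (c : ℝ) :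
    c * Real.log n * (1 - (∫ ω, (pullCount I k n ω : ℝ) ∂law Q) / n) -
      (n : ℝ) ^ (c - 1) * ∑ l ∈ Finset.univ.erase k, ∫ ω, (pullCount I l n ω : ℝ) ∂law Q' ≤
    (∫ ω, (pullCount I k n ω : ℝ) ∂law Q) * ∫ z, llr (Q k) (Q' k) z ∂Q k := by
  have hn' : (0 : ℝ) < n := Nat.cast_pos.2 hn
  -- The fraction of pulls of other arms: near one in mean under `Q`, near zero under `Q'`. The test
  -- function is `x * (c * log n)`.
  set x : Outcome K → ℝ := fun ω => 1 - (pullCount I k n ω : ℝ) / n with hx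
  have hxm : Measurable[history I n] x := ((measurable_pullCount hI k n).div_const _).const_sub _
  have hxm' : Measurable x := hxm.mono (history_le hI n) le_rfl
  have hxsum : ∀ ω, x ω = (∑ l ∈ Finset.univ.erase k, (pullCount I l n ω : ℝ)) / n := by
    intro ω
    have h1 := sum_pullCount I n ω
    rw [← Finset.add_sum_erase _ _ (Finset.mem_univ k)] at h1
    have h2 : (pullCount I k n ω : ℝ) + ∑ l ∈ Finset.univ.erase k, (pullCount I l n ω : ℝ) = n := by
      exact_mod_cast h1
    rw [hx, eq_div_iff hn'.ne', sub_mul, div_mul_cancel₀ _ hn'.ne']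
    linarith
  have hx0 : ∀ ω, 0 ≤ x ω := fun ω => by rw [hxsum]; positivity
  have hx1 : ∀ ω, x ω ≤ 1 := fun ω => by
    have : 0 ≤ (pullCount I k n ω : ℝ) / n := by positivity
    simp only [hx]; linarith
  have hxi : Integrable x (law Q) :=
    (integrable_const _).sub ((integrable_pullCount Q hI k n).div_const _)
  have hxi' : Integrable x (law Q') :=
    (integrable_const _).sub ((integrable_pullCount Q' hI k n).div_const _)
  have hpt : ∀ ω, Real.exp (x ω * (c * Real.log n)) ≤ 1 + x ω * (n : ℝ) ^ c := by
    intro ω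
    rw [Real.rpow_def_of_pos hn', mul_comm (Real.log n)]
    exact exp_mul_le (hx0 ω) (hx1 ω) _
  have hbi : Integrable (fun ω => 1 + x ω * (n : ℝ) ^ c) (law Q') :=
    (integrable_const _).add (hxi'.mul_const _)
  have hei : Integrable (fun ω => Real.exp (x ω * (c * Real.log n))) (law Q') := by
    refine hbi.mono' (Real.measurable_exp.comp (hxm'.mul_const _)).aestronglyMeasurable
      (Eventually.of_forall fun ω => ?_)
    rw [Real.norm_eq_abs, abs_of_pos (Real.exp_pos _)]
    exact hpt ω
  have h1 := le_integral_pullCount_mul hI hQ hac hllr n (hxm.mul_const (c * Real.log n))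
    (hxi.mul_const _) hei
  have h2 := integral_mono hei hbi hpt
  rw [integral_add (integrable_const _) (hxi'.mul_const _), integral_mul_const,
    integral_const, probReal_univ, one_smul] at h2
  rw [integral_mul_const] at h1
  have e1 : ∫ ω, x ω ∂law Q = 1 - (∫ ω, (pullCount I k n ω : ℝ) ∂law Q) / n := by
    rw [hx, integral_sub (integrable_const _) ((integrable_pullCount Q hI k n).div_const _),
      integral_div]
    simp
  have e2 : ∫ ω, x ω ∂law Q' =
      (∑ l ∈ Finset.univ.erase k, ∫ ω, (pullCount I l n ω : ℝ) ∂law Q') / n := by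
    simp only [hxsum]
    rw [integral_div, integral_finsetSum _ fun l _ => integrable_pullCount Q' hI l n]
  rw [e1] at h1
  rw [e2] at h2
  have e3 : (∑ l ∈ Finset.univ.erase k, ∫ ω, (pullCount I l n ω : ℝ) ∂law Q') / n * (n : ℝ) ^ c =
      (n : ℝ) ^ (c - 1) * ∑ l ∈ Finset.univ.erase k, ∫ ω, (pullCount I l n ω : ℝ) ∂law Q' := by
    rw [Real.rpow_sub_one hn'.ne']; ring
  rw [e3] at h2
  linarith

/-- The Lai-Robbins bound for one arm and one alternative. -/
lemma eventually_mul_log_le {Q Q' : Fin K → Measure (ℝ × ℝ)}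
    [∀ k, IsProbabilityMeasure (Q k)] [∀ k, IsProbabilityMeasure (Q' k)]
    {I : ℕ → Outcome K → Fin K} (hI : Admissible I) {k : Fin K}
    (hQ : ∀ l, l ≠ k → Q l = Q' l) (hac : Q k ≪ Q' k)
    (hllr : Integrable (llr (Q k) (Q' k)) (Q k))
    (hk : (fun n : ℕ => ∫ ω, (pullCount I k n ω : ℝ) ∂law Q)
      =o[atTop] (fun n : ℕ => (n : ℝ) ^ (1 : ℝ)))
    (hl : ∀ l, l ≠ k → ∀ a : ℝ, 0 < a →
      (fun n : ℕ => ∫ ω, (pullCount I l n ω : ℝ) ∂law Q')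
        =o[atTop] (fun n : ℕ => (n : ℝ) ^ a))
    {b : ℝ} (hb : b < 1) :
    ∀ᶠ n : ℕ in atTop, b * Real.log n ≤
      (∫ ω, (pullCount I k n ω : ℝ) ∂law Q) * ∫ z, llr (Q k) (Q' k) z ∂Q k := by
  -- In `b < b' < c < 1`, the ratio `b' / c < 1` absorbs `E[T_k(n)] / n`, the difference `b' - b`
  -- absorbs an error of at most one, and `c < 1` lets consistency bound that error.
  obtain ⟨b', hb', hb1⟩ := exists_between (max_lt hb one_pos)
  have hbb : b < b' := (le_max_left _ _).trans_lt hb'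
  have hb0 : 0 < b' := (le_max_right _ _).trans_lt hb'
  obtain ⟨c, hbc, hc1⟩ := exists_between hb1
  have hc0 : 0 < c := hb0.trans hbc
  have hsum : (fun n : ℕ => ∑ l ∈ Finset.univ.erase k, ∫ ω, (pullCount I l n ω : ℝ) ∂law Q')
      =o[atTop] (fun n : ℕ => (n : ℝ) ^ (1 - c)) :=
    Asymptotics.IsLittleO.fun_sum fun l hlk => hl l (Finset.ne_of_mem_erase hlk) _ (by linarith)
  have h1 := hk.def (c := 1 - b' / c) (sub_pos.2 ((div_lt_one hc0).2 hbc))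
  have h2 := hsum.def one_pos
  have h3 : ∀ᶠ n : ℕ in atTop, 1 / (b' - b) ≤ Real.log n :=
    (Real.tendsto_log_atTop.comp tendsto_natCast_atTop_atTop).eventually_ge_atTop _
  filter_upwards [h1, h2, h3, eventually_gt_atTop 0] with n h1 h2 h3 hn
  have hn' : (0 : ℝ) < n := Nat.cast_pos.2 hn
  have hT : 0 ≤ ∫ ω, (pullCount I k n ω : ℝ) ∂law Q :=
    integral_nonneg fun ω => Nat.cast_nonneg _
  have hU : 0 ≤ ∑ l ∈ Finset.univ.erase k, ∫ ω, (pullCount I l n ω : ℝ) ∂law Q' :=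
    Finset.sum_nonneg fun l _ => integral_nonneg fun ω => Nat.cast_nonneg _
  rw [Real.norm_of_nonneg hT, Real.rpow_one, Real.norm_of_nonneg hn'.le, ← div_le_iff₀ hn'] at h1
  rw [Real.norm_of_nonneg hU, Real.norm_of_nonneg (by positivity), one_mul] at h2
  refine le_trans ?_ (log_mul_le_integral_pullCount_mul hI hQ hac hllr hn c)
  have h4 : (n : ℝ) ^ (c - 1) *
      ∑ l ∈ Finset.univ.erase k, ∫ ω, (pullCount I l n ω : ℝ) ∂law Q' ≤ 1 := by
    refine (mul_le_mul_of_nonneg_left h2 (by positivity)).trans_eq ?_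
    rw [← Real.rpow_add hn']; simp
  have h5 : 1 ≤ Real.log n * (b' - b) := (div_le_iff₀ (sub_pos.2 hbb)).1 h3
  have hlog : 0 ≤ Real.log n := Real.log_natCast_nonneg n
  have h6 : b' ≤ c * (1 - (∫ ω, (pullCount I k n ω : ℝ) ∂law Q) / n) := by
    have := mul_le_mul_of_nonneg_left h1 hc0.le
    rw [mul_sub, mul_div_cancel₀ _ hc0.ne'] at this
    linarith
  have h7 := mul_le_mul_of_nonneg_left h6 hlog
  linarith

/-- `minKL` allows rates equal to `r*`, but consistency under the alternative restrains the other
arms only if arm `k` is strictly better. Denseness supplies a nearby strictly better parameter, and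
continuity keeps its divergence below `w / x`. -/
lemma eventually_mul_log_le_of_lt_div_minKL [NeZero K] {Θ : Fin K → Type*}
    [∀ k, TopologicalSpace (Θ k)] (P : ∀ k, Θ k → Measure (ℝ × ℝ))
    [∀ k t, IsProbabilityMeasure (P k t)]
    (hdense : ∀ k (t : Θ k), t ∈ closure {s : Θ k | rate (P k t) < rate (P k s)})
    (θ : ∀ k, Θ k)
    (hcont : ∀ k, Continuous (fun t : Θ k => InformationTheory.klDiv (P k (θ k)) (P k t)))
    (I : ℕ → Outcome K → Fin K) (hI : Admissible I)
    (hconsistent : ∀ (ϑ : ∀ k, Θ k) (k : Fin K),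
      rate (P k (ϑ k)) < optRate (fun j => P j (ϑ j)) → ∀ a : ℝ, 0 < a →
        (fun n : ℕ => ∫ ω, (pullCount I k n ω : ℝ) ∂(law (fun j => P j (ϑ j))))
          =o[atTop] (fun n : ℕ => (n : ℝ) ^ a))
    {k : Fin K} (hk : 0 < gap (fun j => P j (θ j)) k) {w : ℝ} (hw : 0 < w) {x : ℝ} (hx : 0 < x)
    (hlt : ENNReal.ofReal x <
      ENNReal.ofReal w / minKL (P k (θ k)) (P k) (optRate (fun j => P j (θ j)))) :
    ∀ᶠ n : ℕ in atTop, x * Real.log n ≤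
      w * ∫ ω, (pullCount I k n ω : ℝ) ∂(law (fun j => P j (θ j))) := by
  have hmin : minKL (P k (θ k)) (P k) (optRate (fun j => P j (θ j))) <
      ENNReal.ofReal (w / x) := by
    rw [ENNReal.ofReal_div_of_pos hx]
    have hx0 : ENNReal.ofReal x ≠ 0 := by simpa using hx
    rw [ENNReal.lt_div_iff_mul_lt (.inl hx0) (.inl ENNReal.ofReal_ne_top)]
    exact ENNReal.mul_lt_of_lt_div' hlt
  obtain ⟨t, ht⟩ := iInf_lt_iff.1 hmin
  obtain ⟨htr, ht⟩ := iInf_lt_iff.1 ht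
  obtain ⟨s, hs, hst⟩ := mem_closure_iff.1 (hdense k t) _
    ((hcont k).isOpen_preimage _ isOpen_Iio) ht
  have hs : InformationTheory.klDiv (P k (θ k)) (P k s) < ENNReal.ofReal (w / x) := hs
  have hrs : optRate (fun j => P j (θ j)) < rate (P k s) :=
    lt_of_le_of_lt (show _ ≤ _ from htr) hst
  have hne := ne_top_of_lt hs
  obtain ⟨hac, hllr⟩ := InformationTheory.klDiv_ne_top_iff.1 hne
  have hD := InformationTheory.toReal_klDiv_of_measure_eq hac (by simp)
  set ϑ : ∀ j, Θ j := Function.update θ k s with hϑ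
  have hϑk : P k (ϑ k) = P k s := by rw [hϑ, Function.update_self]
  have hϑl : ∀ l, l ≠ k → P l (θ l) = P l (ϑ l) := fun l hl => by
    rw [hϑ, Function.update_of_ne hl]
  have hle : ∀ l, rate (P l (θ l)) ≤ optRate (fun j => P j (θ j)) := fun l =>
    le_ciSup (f := fun j => rate (P j (θ j))) (Set.finite_range _).bddAbove l
  have hle' : rate (P k s) ≤ optRate (fun j => P j (ϑ j)) := by
    rw [← hϑk]
    exact le_ciSup (f := fun j => rate (P j (ϑ j))) (Set.finite_range _).bddAbove k
  have hD' : (InformationTheory.klDiv (P k (θ k)) (P k s)).toReal < w / x :=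
    (ENNReal.lt_ofReal_iff_toReal_lt hne).1 hs
  -- `D` replaces the divergence: it is certainly positive, hence can be cancelled, and still makes
  -- `x * D / w < 1`.
  obtain ⟨D, hD1, hD2⟩ := exists_between hD'
  have hD0 : 0 < D := ENNReal.toReal_nonneg.trans_lt hD1
  have hbound := eventually_mul_log_le (Q := fun j => P j (θ j)) (Q' := fun j => P j (ϑ j)) hI
    (k := k) hϑl (by rw [hϑk]; exact hac) (by rw [hϑk]; exact hllr)
    (hconsistent θ k (sub_pos.1 hk) 1 one_pos)
    (fun l hl => hconsistent ϑ l (by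
      rw [← hϑl l hl]; exact (hle l).trans_lt (hrs.trans_le hle')))
    (b := x * D / w) (by
      rw [lt_div_iff₀ hx] at hD2
      rw [div_lt_one hw]; linarith)
  filter_upwards [hbound] with n hn
  have hT : 0 ≤ ∫ ω, (pullCount I k n ω : ℝ) ∂(law (fun j => P j (θ j))) :=
    integral_nonneg fun ω => Nat.cast_nonneg _
  simp only [hϑk] at hn
  rw [← hD] at hn
  have h1 := hn.trans (mul_le_mul_of_nonneg_left hD1.le hT)
  have h2 : x * D / w * Real.log n = D * (x * Real.log n / w) := by ring
  rw [h2, mul_comm _ D, mul_le_mul_iff_right₀ hD0, div_le_iff₀ hw] at h1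
  linarith

end BudgetBandit

end

/-! ### From pulls to regret on the scale of `log B`. -/

noncomputable section

namespace BudgetBandit

/-- The costs of admissible policies exceed every budget by a bounded expected amount. -/
lemma exists_overshoot_bound {K : ℕ} (Q : Fin K → Measure (ℝ × ℝ))
    [∀ k, IsProbabilityMeasure (Q k)] (hpos : ∀ k, 0 < meanCost (Q k)) {γ : ℝ} (hγ : 0 < γ)
    (hX : ∀ k, Integrable (fun z : ℝ × ℝ => z.1) (Q k))
    (hmom : ∀ k, MemLp (fun z : ℝ × ℝ => z.1) (ENNReal.ofReal (2 + γ)) (Q k)) :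
    ∃ C : ℝ, ∀ B : ℝ, 0 ≤ B → ∀ J : ℕ → Outcome K → Fin K, Admissible J → ∀ n,
      ∑ i ∈ Finset.range n, ∫ ω in alive J B i, (obs J i ω).1 ∂law Q ≤ B + C := by
  have hXm : ∀ k, Integrable (fun z : ℝ × ℝ => |z.1| ^ (2 + γ)) (Q k) := by
    intro k
    have := (hmom k).integrable_norm_rpow (by simpa using by linarith) ENNReal.ofReal_ne_top
    rw [ENNReal.toReal_ofReal (by linarith)] at this
    simpa using this
  set M := ∑ k, ∫ z, |z.1| ^ (2 + γ) ∂Q k with hM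
  have hMk : ∀ k, ∫ z, |z.1| ^ (2 + γ) ∂Q k ≤ M := fun k =>
    Finset.single_le_sum (f := fun k => ∫ z, |z.1| ^ (2 + γ) ∂Q k)
      (fun l _ => integral_nonneg fun z => by positivity) (Finset.mem_univ k)
  -- The drift condition holds for large `L`; the choice involves neither the budget nor the policy.
  have hev : ∀ᶠ L : ℝ in atTop, ∀ k, 2 * M ≤ L ^ (1 + γ) * meanCost (Q k) :=
    eventually_all.2 fun k =>
      ((tendsto_rpow_atTop (by linarith)).atTop_mul_const (hpos k)).eventually_ge_atTop _
  obtain ⟨L, hLM, hL⟩ := (hev.and (eventually_gt_atTop 0)).exists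
  refine ⟨L / γ + 2 * L, fun B hB J hJ n => ?_⟩
  have h1 := sum_setIntegral_cost_le Q hJ hX hB n
  have h2 := sum_overshoot_le Q hJ hX hL hγ hXm hMk hLM hB n
  linarith

lemma half_log_sub_le_log_floor_sqrt {B : ℝ} (hB : 4 ≤ B) :
    1 / 2 * Real.log B - Real.log 2 ≤ Real.log (⌊Real.sqrt B⌋₊ : ℝ) := by
  have h2 : 2 ≤ Real.sqrt B := Real.le_sqrt_of_sq_le (by linarith)
  have h3 : Real.sqrt B / 2 ≤ (⌊Real.sqrt B⌋₊ : ℝ) := by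
    have := Nat.sub_one_lt_floor (Real.sqrt B)
    linarith
  have h4 := Real.log_le_log (by linarith) h3
  rw [Real.log_div (by linarith) two_ne_zero, Real.log_sqrt (by linarith)] at h4
  linarith

/-- A lower bound on the pulls of the suboptimal arms gives one on the regret. -/
lemma le_liminf_regret {K : ℕ} [NeZero K] (Q : Fin K → Measure (ℝ × ℝ))
    [∀ k, IsProbabilityMeasure (Q k)] (hpos : ∀ k, 0 < meanCost (Q k)) {γ : ℝ} (hγ : 0 < γ)
    (hX : ∀ k, Integrable (fun z : ℝ × ℝ => z.1) (Q k))
    (hR : ∀ k, Integrable (fun z : ℝ × ℝ => z.2) (Q k))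
    (hmom : ∀ k, MemLp (fun z : ℝ × ℝ => z.1) (ENNReal.ofReal (2 + γ)) (Q k))
    {I : ℕ → Outcome K → Fin K} (hI : Admissible I) {x : Fin K → ℝ} (hx : ∀ k, 0 ≤ x k)
    (hlog : ∀ k, 0 < gap Q k → ∀ᶠ n : ℕ in atTop, x k * Real.log n ≤
      meanCost (Q k) * gap Q k * ∫ ω, (pullCount I k n ω : ℝ) ∂law Q) :
    ((1 / 2 * ∑ k with 0 < gap Q k, x k : ℝ) : EReal) ≤
      liminf (fun B : ℝ => regret Q I B / ((Real.log B : ℝ) : EReal)) atTop := by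
  obtain ⟨C, hC⟩ := exists_overshoot_bound Q hpos hγ hX hmom
  set s := ∑ k with 0 < gap Q k, x k with hs
  set M := ∑ l, ∫ z, |z.1| ∂Q l with hM
  -- The three bounded losses: rounding `√B` down, exits before epoch `⌊√B⌋`, and the overshoot.
  set c := s * Real.log 2 + ∑ k with 0 < gap Q k, meanCost (Q k) * gap Q k * M +
    |optRate Q| * C with hc
  have hgap : ∀ k, 0 ≤ gap Q k := fun k =>
    sub_nonneg.2 (le_ciSup (f := fun k => rate (Q k)) (Set.finite_range _).bddAbove k)
  have hlim : Tendsto (fun B : ℝ => ((1 / 2 * s - c / Real.log B : ℝ) : EReal)) atTop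
      (𝓝 ((1 / 2 * s : ℝ) : EReal)) := by
    refine (continuous_coe_real_ereal.tendsto _).comp ?_
    simpa using (Real.tendsto_log_atTop.const_div_atTop c).const_sub (1 / 2 * s)
  rw [← hlim.liminf_eq]
  have hfloor : Tendsto (fun B : ℝ => ⌊Real.sqrt B⌋₊) atTop atTop :=
    tendsto_nat_floor_atTop.comp Real.tendsto_sqrt_atTop
  have hall : ∀ᶠ B : ℝ in atTop, ∀ k, 0 < gap Q k → x k * Real.log (⌊Real.sqrt B⌋₊ : ℝ) ≤
      meanCost (Q k) * gap Q k * ∫ ω, (pullCount I k ⌊Real.sqrt B⌋₊ ω : ℝ) ∂law Q :=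
    hfloor.eventually (eventually_all.2 fun k => eventually_imp_distrib_left.2 (hlog k))
  refine liminf_le_liminf ?_
  filter_upwards [hall, eventually_ge_atTop 4] with B hall hB
  have hB0 : 0 < B := by linarith
  have hlogB : 0 < Real.log B := Real.log_pos (by linarith)
  have hn : ((⌊Real.sqrt B⌋₊ : ℕ) : ℝ) ^ 2 ≤ B := by
    have h1 := Nat.floor_le (Real.sqrt_nonneg B)
    calc ((⌊Real.sqrt B⌋₊ : ℕ) : ℝ) ^ 2 ≤ Real.sqrt B ^ 2 := by gcongr
      _ = B := Real.sq_sqrt hB0.le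
  have hterm : ∀ k ∈ Finset.univ.filter (fun k => 0 < gap Q k),
      x k * (1 / 2 * Real.log B - Real.log 2) - meanCost (Q k) * gap Q k * M ≤
        meanCost (Q k) * gap Q k * budgetPulls Q I B k := by
    intro k hk
    have h1 := hall k (Finset.mem_filter.1 hk).2
    have h2 := mul_le_mul_of_nonneg_left (half_log_sub_le_log_floor_sqrt hB) (hx k)
    have h3 := mul_le_mul_of_nonneg_left
      (le_budgetPulls Q hI hX hpos hB0 (hC B hB0.le I hI) k hn)
      (mul_nonneg (hpos k).le (hgap k))
    rw [mul_sub] at h3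
    linarith
  have hsum := Finset.sum_le_sum hterm
  rw [Finset.sum_sub_distrib, ← Finset.sum_mul, ← hs] at hsum
  have hsum' : ∑ k with 0 < gap Q k, meanCost (Q k) * gap Q k * budgetPulls Q I B k ≤
      ∑ k, meanCost (Q k) * gap Q k * budgetPulls Q I B k :=
    Finset.sum_le_sum_of_subset_of_nonneg (Finset.filter_subset _ _) fun k _ _ =>
      mul_nonneg (mul_nonneg (hpos k).le (hgap k))
        (tsum_nonneg fun i => pullProb_nonneg Q I B i k)
  have hreg := le_regret Q hI hX hR hpos (hC B hB0.le)
  have hreal : (1 / 2 * s - c / Real.log B) ≤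
      (∑ k, meanCost (Q k) * gap Q k * budgetPulls Q I B k - |optRate Q| * C) / Real.log B := by
    rw [le_div_iff₀ hlogB, sub_mul, div_mul_cancel₀ _ hlogB.ne']
    linarith
  refine (EReal.coe_le_coe_iff.2 hreal).trans ?_
  rw [EReal.coe_div]
  exact EReal.div_le_div_right_of_nonneg (EReal.coe_nonneg.2 hlogB.le) hreg

/-- A summand of the bound is infinite when the minimal divergence vanishes, so it is approached by
finite values. The alternative `u m = 0` covers `X = 0`, which has nothing below it. -/
lemma exists_seq_tendsto_of_lt_or_eq_zero (X : ℝ≥0∞) :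
    ∃ u : ℕ → ℝ≥0∞, (∀ m, u m ≠ ∞ ∧ (u m = 0 ∨ u m < X)) ∧ Tendsto u atTop (𝓝 X) := by
  rcases eq_or_ne X 0 with rfl | h
  · exact ⟨fun _ => 0, fun _ => ⟨ENNReal.zero_ne_top, Or.inl rfl⟩, tendsto_const_nhds⟩
  · obtain ⟨u, _, hu, hlim⟩ := exists_seq_strictMono_tendsto' (pos_iff_ne_zero.2 h)
    exact ⟨u, fun m => ⟨ne_top_of_lt (hu m).2, Or.inr (hu m).2⟩, hlim⟩

end BudgetBandit

end

/-- Regret lower bound for budget-constrained bandits. The bandit instance is `θ`; the policy `I`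
is consistent on every instance `ϑ` of the parametric family. -/
theorem theorem3 {K : ℕ} [NeZero K] {Θ : Fin K → Type*} [∀ k, TopologicalSpace (Θ k)]
    (P : ∀ k, Θ k → Measure (ℝ × ℝ)) [∀ k t, IsProbabilityMeasure (P k t)]
    -- every parameter has a well-defined rate, with positive expected cost
    (hX_int : ∀ k t, Integrable (fun z : ℝ × ℝ => z.1) (P k t))
    (hR_int : ∀ k t, Integrable (fun z : ℝ × ℝ => z.2) (P k t))
    (hX_pos : ∀ k t, 0 < BudgetBandit.meanCost (P k t))
    -- finiteness of the divergences
    (hfinite : ∀ k (s t : Θ k), BudgetBandit.rate (P k t) < BudgetBandit.rate (P k s) →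
      InformationTheory.klDiv (P k t) (P k s) < ∞)
    -- denseness: arbitrarily close to every parameter there are parameters of larger rate
    (hdense : ∀ k (t : Θ k),
      t ∈ closure {s : Θ k | BudgetBandit.rate (P k t) < BudgetBandit.rate (P k s)})
    -- the bandit instance, its moments, and continuity of the divergence from it
    (θ : ∀ k, Θ k)
    (γ : ℝ) (hγ : 0 < γ)
    (hX_mom : ∀ k, MemLp (fun z : ℝ × ℝ => z.1) (ENNReal.ofReal (2 + γ)) (P k (θ k)))
    (hR_mom : ∀ k, MemLp (fun z : ℝ × ℝ => z.2) 2 (P k (θ k)))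
    (hcont : ∀ k, Continuous (fun t : Θ k => InformationTheory.klDiv (P k (θ k)) (P k t)))
    -- the policy
    (I : ℕ → BudgetBandit.Outcome K → Fin K) (hI : BudgetBandit.Admissible I)
    (hconsistent : ∀ (ϑ : ∀ k, Θ k) (k : Fin K),
      BudgetBandit.rate (P k (ϑ k)) < BudgetBandit.optRate (fun j => P j (ϑ j)) →
      ∀ a : ℝ, 0 < a →
        (fun n : ℕ => ∫ ω, (BudgetBandit.pullCount I k n ω : ℝ)
            ∂(BudgetBandit.law (fun j => P j (ϑ j))))
          =o[atTop] (fun n : ℕ => (n : ℝ) ^ a)) :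
    (((2 : ℝ≥0∞)⁻¹ * ∑ k with 0 < BudgetBandit.gap (fun j => P j (θ j)) k,
        ENNReal.ofReal (BudgetBandit.meanCost (P k (θ k)) *
            BudgetBandit.gap (fun j => P j (θ j)) k) /
          BudgetBandit.minKL (P k (θ k)) (P k)
            (BudgetBandit.optRate (fun j => P j (θ j))) : ℝ≥0∞) : EReal) ≤
      liminf (fun B : ℝ =>
        BudgetBandit.regret (fun j => P j (θ j)) I B / ((Real.log B : ℝ) : EReal)) atTop := by
  set X : Fin K → ℝ≥0∞ := fun k =>
    ENNReal.ofReal (BudgetBandit.meanCost (P k (θ k)) *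
      BudgetBandit.gap (fun j => P j (θ j)) k) /
      BudgetBandit.minKL (P k (θ k)) (P k) (BudgetBandit.optRate (fun j => P j (θ j))) with hXdef
  choose u hu hlim using fun k => BudgetBandit.exists_seq_tendsto_of_lt_or_eq_zero (X k)
  have hconv : Tendsto (fun m => (((2 : ℝ≥0∞)⁻¹ *
      ∑ k with 0 < BudgetBandit.gap (fun j => P j (θ j)) k, u k m : ℝ≥0∞) : EReal)) atTop
      (𝓝 (((2 : ℝ≥0∞)⁻¹ *
        ∑ k with 0 < BudgetBandit.gap (fun j => P j (θ j)) k, X k : ℝ≥0∞) : EReal)) :=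
    (continuous_coe_ennreal_ereal.tendsto _).comp
      (ENNReal.Tendsto.const_mul (tendsto_finsetSum _ fun k _ => hlim k)
        (Or.inr (by simp)))
  -- It now suffices to treat finite constants, each zero or strictly below its summand; the zero
  -- ones need no information bound.
  refine le_of_tendsto' hconv fun m => ?_
  have h := BudgetBandit.le_liminf_regret (fun j => P j (θ j)) (fun k => hX_pos k (θ k)) hγ
    (fun k => hX_int k (θ k)) (fun k => hR_int k (θ k)) hX_mom hI
    (x := fun k => (u k m).toReal) (fun k => ENNReal.toReal_nonneg) fun k hk => by
      have hT : ∀ n, 0 ≤ ∫ ω, (BudgetBandit.pullCount I k n ω : ℝ)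
          ∂(BudgetBandit.law (fun j => P j (θ j))) :=
        fun n => integral_nonneg fun ω => Nat.cast_nonneg _
      have hw := mul_pos (hX_pos k (θ k)) hk
      rcases eq_or_ne (u k m) 0 with h0 | h0
      · filter_upwards with n
        rw [h0, ENNReal.toReal_zero, zero_mul]
        exact mul_nonneg hw.le (hT n)
      · refine BudgetBandit.eventually_mul_log_le_of_lt_div_minKL P hdense θ hcont I hI
          hconsistent hk hw (ENNReal.toReal_pos h0 (hu k m).1) ?_
        rw [ENNReal.ofReal_toReal (hu k m).1]
        exact (hu k m).2.resolve_left h0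
  refine le_of_eq_of_le ?_ h
  have hfin : (2 : ℝ≥0∞)⁻¹ *
      ∑ k with 0 < BudgetBandit.gap (fun j => P j (θ j)) k, u k m ≠ ∞ :=
    ENNReal.mul_ne_top (by simp) (ENNReal.sum_ne_top.2 fun k _ => (hu k m).1)
  rw [← EReal.coe_ennreal_toReal hfin, ENNReal.toReal_mul,
    ENNReal.toReal_sum fun k _ => (hu k m).1]
  simp
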